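/- **Setting.** Let $G$ be a second countable locally compact Hausdorff group with a right Haar measure $\lambda$. A *Young function* is a continuous, even, convex function $\Phi:\mathbb R\to\mathbb R$ with $\Phi(0)=0$, $\Phi(t)>0$ for $t>0$ and $\lim_{t\to\infty}\Phi(t)=\infty$. Let $\Phi$ be a Young function that is $\Delta_2$-*regular*: there are $M,t_0>0$ with $\Phi(2t)\le M\Phi(t)$ for all $t\ge t_0$ if $G$ is compact, and there is $M>0$ with $\Phi(2t)\le M\Phi(t)$ for all $t>0$ if $G$ is noncompact. The *Orlicz space* $L^\Phi(G)$ consists of the Borel functions $f:G\to\mathbb C$, modulo equality $\lambda$-almost everywhere, with $\int_G\Phi(\alpha|f|)\,d\lambda<\infty$ for some $\alpha>0$; its norm is the Luxemburg norm $N_\Phi(f)=\inf\{k>0:\int_G\Phi(|f|/k)\,d\lambda\le1\}$. Let $a\in G$ be *aperiodic*, that is, the closed subgroup generated by $a$ is not compact. Let $L\ge2$, let $w_1,\dots,w_L:G\to(0,\infty)$ be bounded continuous functions with $w_l^{-1}\in L^\infty(G)$, and let $T_l$ be the weighted translation on $L^\Phi(G)$ given by $(T_lf)(x)=w_l(x)f(xa^{-1})$.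 Let $1\le r_1<r_2<\dots<r_L$ be integers. For $n\ge 0$ and $x\in G$ put $$\varphi_{l,n}(x)=\prod_{j=1}^n w_l(xa^j),\qquad \widetilde\varphi_{l,n}(x)=\Bigl(\prod_{j=0}^{n-1}w_l(xa^{-j})\Bigr)^{-1}.$$ Operators $S_1,\dots,S_L$ on a normed space $X$ are *disjoint topologically mixing* if for all nonempty open sets $U,V_1,\dots,V_L\subset X$ there is $N$ such that $U\cap S_1^{-n}(V_1)\cap\dots\cap S_L^{-n}(V_L)\ne\emptyset$ for all $n\ge N$. **Corollary 2.6 (disjoint topologically mixing).** The following conditions are equivalent. (i) $T_1^{r_1},T_2^{r_2},\dots,T_L^{r_L}$ are disjoint topologically mixing on $L^\Phi(G)$. (ii) For each compact set $K\subset G$ with $\lambda(K)>0$ there is a sequence of Borel sets $E_n\subset K$ such that $\lim_{n\to\infty}\lambda(E_n)=\lambda(K)$, for $1\le l\le L$ $$\lim_{n\to\infty}\bigl\|\varphi_{l,r_ln}|_{E_n}\bigr\|_\infty=\lim_{n\to\infty}\bigl\|\widetilde\varphi_{l,r_ln}|_{E_n}\bigr\|_\infty=0,$$ and for $1\le s<l\le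 L$ $$\lim_{n\to\infty}\Bigl\|\frac{\widetilde\varphi_{s,(r_l-r_s)n}\cdot\widetilde\varphi_{l,r_ln}}{\widetilde\varphi_{s,r_ln}}\Big|_{E_n}\Bigr\|_\infty=\lim_{n\to\infty}\Bigl\|\frac{\varphi_{l,(r_l-r_s)n}\cdot\widetilde\varphi_{s,r_sn}}{\widetilde\varphi_{l,r_sn}}\Big|_{E_n}\Bigr\|_\infty=0.$$ -/

import Mathlib

open MeasureTheory Filter Topology
open scoped ENNReal

set_option linter.unusedSectionVars false

noncomputable section

/-! ### Young functions -/

/-- A Young function: a continuous, even and convex function `Φ : ℝ → ℝ` with `Φ 0 = 0`,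
`Φ t > 0` for `t > 0`, and `Φ t → ∞` as `t → ∞`. -/
structure YoungFunction where
  toFun : ℝ → ℝ
  continuous' : Continuous toFun
  even' : ∀ t, toFun (-t) = toFun t
  convex' : ConvexOn ℝ Set.univ toFun
  zero' : toFun 0 = 0
  pos' : ∀ t, 0 < t → 0 < toFun t
  tendsto' : Tendsto toFun atTop atTop

namespace YoungFunction

instance : CoeFun YoungFunction (fun _ => ℝ → ℝ) := ⟨toFun⟩

/-- `Φ` is `Δ₂`-regular with respect to the group `G`: there are `M > 0` and `t₀ > 0` with
`Φ (2t) ≤ M Φ t` for `t ≥ t₀` when `G` is compact, and `Φ (2t) ≤ M Φ t` for all `t > 0` when `G` is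
noncompact. -/
def IsDelta2Regular (Φ : YoungFunction) (G : Type*) [TopologicalSpace G] : Prop :=
  (CompactSpace G → ∃ M > 0, ∃ t₀ > 0, ∀ t ≥ t₀, Φ (2 * t) ≤ M * Φ t) ∧
  (¬ CompactSpace G → ∃ M > 0, ∀ t > 0, Φ (2 * t) ≤ M * Φ t)

theorem nonneg (Φ : YoungFunction) {t : ℝ} (ht : 0 ≤ t) : 0 ≤ Φ t := by
  rcases ht.eq_or_lt with h | h
  · rw [← h, Φ.zero']
  · exact (Φ.pos' t h).le

theorem measurable (Φ : YoungFunction) : Measurable Φ := Φ.continuous'.measurable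

theorem mul_le (Φ : YoungFunction) {c : ℝ} (t : ℝ) (hc : 0 ≤ c) (hc1 : c ≤ 1) :
    Φ (c * t) ≤ c * Φ t := by
  have h := Φ.convex'.2 (Set.mem_univ t) (Set.mem_univ 0) hc (sub_nonneg.2 hc1) (by ring)
  simpa [Φ.zero'] using h

theorem mono (Φ : YoungFunction) {s t : ℝ} (hs : 0 ≤ s) (hst : s ≤ t) : Φ s ≤ Φ t := by
  rcases (hs.trans hst).eq_or_lt with h | h
  · have : s = t := by linarith
    rw [this]
  · have h1 := Φ.mul_le (c := s / t) t (by positivity) ((div_le_one h).2 hst)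
    rw [div_mul_cancel₀ _ h.ne'] at h1
    refine h1.trans ?_
    exact mul_le_of_le_one_left (Φ.nonneg h.le) ((div_le_one h).2 hst)

end YoungFunction

/-! ### The Orlicz space and the Luxemburg norm -/

section Orlicz

variable {α : Type*} [MeasurableSpace α]

/-- The integral `∫ Φ(|f| / k) dμ`, with values in `[0, ∞]`. -/
def orliczModular (Φ : YoungFunction) (μ : Measure α) (f : α → ℂ) (k : ℝ) : ℝ≥0∞ :=
  ∫⁻ x, ENNReal.ofReal (Φ (‖f x‖ / k)) ∂μ

/-- The Luxemburg norm `N_Φ(f) = inf {k > 0 : ∫ Φ(|f| / k) dμ ≤ 1}`. -/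
def luxemburgNorm (Φ : YoungFunction) (μ : Measure α) (f : α → ℂ) : ℝ :=
  sInf {k : ℝ | 0 < k ∧ orliczModular Φ μ f k ≤ 1}

variable {Φ : YoungFunction} {μ : Measure α} {f g : α → ℂ} {k l : ℝ}

theorem orliczModular_congr (h : f =ᵐ[μ] g) (k : ℝ) :
    orliczModular Φ μ f k = orliczModular Φ μ g k :=
  lintegral_congr_ae (h.mono fun x hx => by simp only [hx])

theorem orliczModular_le_of_norm_le {c : ℝ} (hk : 0 < k) (hc : 0 < c)
    (h : ∀ᵐ x ∂μ, ‖f x‖ ≤ c * ‖g x‖) :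
    orliczModular Φ μ f (c * k) ≤ orliczModular Φ μ g k := by
  refine lintegral_mono_ae (h.mono fun x hx => ENNReal.ofReal_le_ofReal ?_)
  refine Φ.mono (by positivity) ?_
  rw [div_le_div_iff₀ (by positivity) hk]
  nlinarith

theorem orliczModular_anti (hk : 0 < k) (hkl : k ≤ l) :
    orliczModular Φ μ f l ≤ orliczModular Φ μ f k := by
  refine lintegral_mono fun x => ENNReal.ofReal_le_ofReal (Φ.mono ?_ ?_)
  · have := hk.trans_le hkl
    positivity
  · gcongr

theorem orliczModular_mul_le (hk : 0 < k) {c : ℝ} (hc : 1 ≤ c) :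
    orliczModular Φ μ f (c * k) ≤ ENNReal.ofReal c⁻¹ * orliczModular Φ μ f k := by
  have hc0 : 0 < c := by linarith
  unfold orliczModular
  rw [← lintegral_const_mul' _ _ ENNReal.ofReal_ne_top]
  refine lintegral_mono fun x => ?_
  rw [← ENNReal.ofReal_mul (by positivity)]
  refine ENNReal.ofReal_le_ofReal ?_
  have := Φ.mul_le (c := c⁻¹) (‖f x‖ / k) (by positivity) (inv_le_one_of_one_le₀ hc)
  refine le_trans (le_of_eq ?_) this
  congr 1
  field_simp

theorem orliczModular_add_le (hf : Measurable f) (hk : 0 < k) (hl : 0 < l) :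
    orliczModular Φ μ (f + g) (k + l) ≤
      ENNReal.ofReal (k / (k + l)) * orliczModular Φ μ f k +
        ENNReal.ofReal (l / (k + l)) * orliczModular Φ μ g l := by
  unfold orliczModular
  rw [← lintegral_const_mul' _ _ ENNReal.ofReal_ne_top,
    ← lintegral_const_mul' _ _ ENNReal.ofReal_ne_top, ← lintegral_add_left]
  swap
  · exact ((Φ.measurable.comp (hf.norm.div_const k)).ennreal_ofReal).const_mul _
  refine lintegral_mono fun x => ?_
  rw [← ENNReal.ofReal_mul (by positivity), ← ENNReal.ofReal_mul (by positivity),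
    ← ENNReal.ofReal_add
      (mul_nonneg (by positivity) (Φ.nonneg (by positivity)))
      (mul_nonneg (by positivity) (Φ.nonneg (by positivity)))]
  refine ENNReal.ofReal_le_ofReal ?_
  have h1 : Φ (‖(f + g) x‖ / (k + l)) ≤ Φ (k / (k + l) * (‖f x‖ / k) + l / (k + l) * (‖g x‖ / l)) := by
    refine Φ.mono (by positivity) ?_
    have : k / (k + l) * (‖f x‖ / k) + l / (k + l) * (‖g x‖ / l) = (‖f x‖ + ‖g x‖) / (k + l) := by
      field_simp
    rw [this]
    have := norm_add_le (f x) (g x)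
    simp only [Pi.add_apply]
    gcongr
  refine h1.trans ?_
  have := Φ.convex'.2 (Set.mem_univ (‖f x‖ / k)) (Set.mem_univ (‖g x‖ / l))
    (show 0 ≤ k / (k + l) by positivity) (show 0 ≤ l / (k + l) by positivity) (by field_simp)
  simpa using this

theorem exists_orliczModular_le_one (hk : 0 < k) (h : orliczModular Φ μ f k < ∞) :
    ∃ l, 0 < l ∧ orliczModular Φ μ f l ≤ 1 := by
  set m := (orliczModular Φ μ f k).toReal with hm
  have hm0 : 0 ≤ m := ENNReal.toReal_nonneg
  refine ⟨(1 + m) * k, by positivity, ?_⟩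
  refine (orliczModular_mul_le hk (by linarith)).trans ?_
  rw [← ENNReal.ofReal_toReal h.ne, ← hm, ← ENNReal.ofReal_mul (by positivity),
    ENNReal.ofReal_le_one, inv_mul_le_one₀ (by positivity)]
  linarith

theorem luxemburgNorm_nonneg : 0 ≤ luxemburgNorm Φ μ f :=
  Real.sInf_nonneg fun _ hk => hk.1.le

theorem luxemburgNorm_le (hk : 0 < k) (h : orliczModular Φ μ f k ≤ 1) :
    luxemburgNorm Φ μ f ≤ k :=
  csInf_le ⟨0, fun _ hk => hk.1.le⟩ ⟨hk, h⟩

theorem luxemburgNorm_le_of_modular_le {c : ℝ} (hc : 0 < c)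
    (hg : ∃ k, 0 < k ∧ orliczModular Φ μ g k ≤ 1)
    (h : ∀ k, 0 < k → orliczModular Φ μ f (c * k) ≤ orliczModular Φ μ g k) :
    luxemburgNorm Φ μ f ≤ c * luxemburgNorm Φ μ g := by
  rw [← div_le_iff₀' hc]
  refine le_csInf hg fun k hk => ?_
  rw [div_le_iff₀' hc]
  exact luxemburgNorm_le (mul_pos hc hk.1) ((h k hk.1).trans hk.2)

/-- The Orlicz space `L^Φ(μ)` of (classes modulo a.e. equality of) measurable functions
`f : α → ℂ` such that `∫ Φ(β |f|) dμ < ∞` for some `β > 0`. -/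
def OrliczSpace (Φ : YoungFunction) (μ : Measure α) : Submodule ℂ (α →ₘ[μ] ℂ) where
  carrier := {f | ∃ β : ℝ, 0 < β ∧ ∫⁻ x, ENNReal.ofReal (Φ (β * ‖f x‖)) ∂μ < ∞}
  zero_mem' := by
    refine ⟨1, one_pos, ?_⟩
    have : ∫⁻ x, ENNReal.ofReal (Φ (1 * ‖(0 : α →ₘ[μ] ℂ) x‖)) ∂μ = ∫⁻ _, 0 ∂μ := by
      refine lintegral_congr_ae ?_
      filter_upwards [AEEqFun.coeFn_zero (α := α) (μ := μ) (β := ℂ)] with x hx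
      simp [hx, Φ.zero']
    rw [this]
    simp
  add_mem' := by
    rintro f g ⟨a, ha, hfa⟩ ⟨b, hb, hgb⟩
    refine ⟨(a⁻¹ + b⁻¹)⁻¹, by positivity, ?_⟩
    have h1 := orliczModular_add_le (Φ := Φ) (μ := μ) (f := f) (g := g) f.measurable
      (inv_pos.2 ha) (inv_pos.2 hb)
    rw [← orliczModular_congr (AEEqFun.coeFn_add f g)] at h1
    simp only [orliczModular, div_eq_inv_mul, inv_inv] at h1
    refine h1.trans_lt (ENNReal.add_lt_top.2 ⟨?_, ?_⟩)
    · exact ENNReal.mul_lt_top ENNReal.ofReal_lt_top hfa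
    · exact ENNReal.mul_lt_top ENNReal.ofReal_lt_top hgb
  smul_mem' := by
    rintro c f ⟨a, ha, hfa⟩
    have hc : 0 < ‖c‖ + 1 := by positivity
    refine ⟨((‖c‖ + 1) * a⁻¹)⁻¹, by positivity, ?_⟩
    have h1 := orliczModular_le_of_norm_le (Φ := Φ) (μ := μ) (f := (c • f : α →ₘ[μ] ℂ)) (g := f)
      (inv_pos.2 ha) hc (by
        filter_upwards [AEEqFun.coeFn_smul c f] with x hx
        rw [hx, Pi.smul_apply, norm_smul]
        gcongr
        linarith)
    simp only [orliczModular, div_eq_inv_mul, inv_inv] at h1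
    exact h1.trans_lt hfa

namespace OrliczSpace

theorem exists_modular_le_one (f : OrliczSpace Φ μ) :
    ∃ k, 0 < k ∧ orliczModular Φ μ (f : α →ₘ[μ] ℂ) k ≤ 1 := by
  obtain ⟨a, ha, h⟩ := f.2
  refine exists_orliczModular_le_one (k := a⁻¹) (inv_pos.2 ha) ?_
  simpa only [orliczModular, div_eq_inv_mul, inv_inv] using h

/-- The norm of the Orlicz space is the Luxemburg norm. -/
instance : Norm (OrliczSpace Φ μ) := ⟨fun f => luxemburgNorm Φ μ (f : α →ₘ[μ] ℂ)⟩

theorem norm_def (f : OrliczSpace Φ μ) : ‖f‖ = luxemburgNorm Φ μ (f : α →ₘ[μ] ℂ) := rfl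

theorem norm_zero' : ‖(0 : OrliczSpace Φ μ)‖ = 0 := by
  refine le_antisymm (le_of_forall_pos_le_add fun ε hε => ?_) luxemburgNorm_nonneg
  rw [zero_add]
  refine luxemburgNorm_le hε ?_
  have h0 : (((0 : OrliczSpace Φ μ) : α →ₘ[μ] ℂ) : α → ℂ) =ᵐ[μ] fun _ => 0 := AEEqFun.coeFn_zero
  rw [orliczModular_congr h0]
  simp [orliczModular, Φ.zero']

theorem norm_smul_le' (c : ℂ) (f : OrliczSpace Φ μ) : ‖c • f‖ ≤ ‖c‖ * ‖f‖ := by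
  by_cases hc : c = 0
  · rw [hc, zero_smul, norm_zero', norm_zero, zero_mul]
  · have hc' : 0 < ‖c‖ := norm_pos_iff.2 hc
    refine luxemburgNorm_le_of_modular_le hc' (exists_modular_le_one f) fun k hk => ?_
    refine orliczModular_le_of_norm_le hk hc' ?_
    filter_upwards [AEEqFun.coeFn_smul c (f : α →ₘ[μ] ℂ)] with x hx
    rw [Submodule.coe_smul, hx, Pi.smul_apply, norm_smul]

theorem norm_add_le' (f g : OrliczSpace Φ μ) : ‖f + g‖ ≤ ‖f‖ + ‖g‖ := by
  have key : ∀ k l : ℝ, (0 < k ∧ orliczModular Φ μ (f : α →ₘ[μ] ℂ) k ≤ 1) →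
      (0 < l ∧ orliczModular Φ μ (g : α →ₘ[μ] ℂ) l ≤ 1) → ‖f + g‖ ≤ k + l := by
    rintro k l ⟨hk, hfk⟩ ⟨hl, hgl⟩
    refine luxemburgNorm_le (by positivity) ?_
    rw [Submodule.coe_add, orliczModular_congr (AEEqFun.coeFn_add _ _)]
    refine (orliczModular_add_le (f : α →ₘ[μ] ℂ).measurable hk hl).trans ?_
    calc _ ≤ ENNReal.ofReal (k / (k + l)) * 1 + ENNReal.ofReal (l / (k + l)) * 1 := by gcongr
      _ = 1 := by
        rw [mul_one, mul_one, ← ENNReal.ofReal_add (by positivity) (by positivity),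
          ENNReal.ofReal_eq_one]
        field_simp
  rw [← sub_le_iff_le_add]
  refine le_csInf (exists_modular_le_one f) fun k hk => ?_
  rw [sub_le_comm]
  refine le_csInf (exists_modular_le_one g) fun l hl => ?_
  rw [sub_le_iff_le_add']
  exact key k l hk hl

theorem eq_zero_of_norm_eq_zero (f : OrliczSpace Φ μ) (hf : ‖f‖ = 0) : f = 0 := by
  have h1 : ∀ k : ℝ, 0 < k → orliczModular Φ μ (f : α →ₘ[μ] ℂ) k ≤ 1 := by
    intro k hk
    obtain ⟨l, hl, hlk⟩ := exists_lt_of_csInf_lt (exists_modular_le_one f)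
      (show sInf _ < k from (show sInf _ = (0 : ℝ) from hf).trans_lt hk)
    exact (orliczModular_anti hl.1 hlk.le).trans hl.2
  have h2 : ∀ c : ℝ, 1 ≤ c →
      orliczModular Φ μ (f : α →ₘ[μ] ℂ) 1 ≤ ENNReal.ofReal c⁻¹ := by
    intro c hc
    have hc0 : 0 < c := by linarith
    have := orliczModular_mul_le (Φ := Φ) (μ := μ) (f := (f : α →ₘ[μ] ℂ))
      (inv_pos.2 hc0) hc
    rw [mul_inv_cancel₀ hc0.ne'] at this
    exact this.trans (mul_le_of_le_one_right' (h1 _ (inv_pos.2 hc0)))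
  have h3 : orliczModular Φ μ (f : α →ₘ[μ] ℂ) 1 = 0 := by
    have ht : Tendsto (fun c : ℝ => ENNReal.ofReal c⁻¹) atTop (𝓝 0) := by
      simpa using ENNReal.tendsto_ofReal tendsto_inv_atTop_zero
    exact le_antisymm (ge_of_tendsto ht ((eventually_ge_atTop 1).mono h2)) zero_le
  have hmeas : Measurable fun x => ENNReal.ofReal (Φ (‖(f : α →ₘ[μ] ℂ) x‖ / 1)) :=
    (Φ.measurable.comp ((f : α →ₘ[μ] ℂ).measurable.norm.div_const 1)).ennreal_ofReal
  have h4 := (lintegral_eq_zero_iff hmeas).1 h3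
  apply Subtype.ext
  apply AEEqFun.ext
  refine EventuallyEq.trans ?_ (AEEqFun.coeFn_zero (α := α) (μ := μ) (β := ℂ)).symm
  filter_upwards [h4] with x hx
  by_contra hne
  have h5 := Φ.pos' ‖(f : α →ₘ[μ] ℂ) x‖ (norm_pos_iff.2 hne)
  simp only [div_one, Pi.zero_apply, ENNReal.ofReal_eq_zero] at hx
  exact absurd hx (not_le.2 h5)

theorem normedSpaceCore : NormedSpace.Core ℂ (OrliczSpace Φ μ) where
  norm_nonneg _ := luxemburgNorm_nonneg
  norm_smul c f := by
    refine le_antisymm (norm_smul_le' c f) ?_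
    by_cases hc : c = 0
    · rw [hc, norm_zero, zero_mul]
      exact luxemburgNorm_nonneg
    · have h := norm_smul_le' c⁻¹ (c • f)
      rw [smul_smul, inv_mul_cancel₀ hc, one_smul, norm_inv] at h
      rwa [le_inv_mul_iff₀ (norm_pos_iff.2 hc)] at h
  norm_triangle := norm_add_le'
  norm_eq_zero_iff f := ⟨eq_zero_of_norm_eq_zero f, fun h => by rw [h, norm_zero']⟩

instance : NormedAddCommGroup (OrliczSpace Φ μ) := NormedAddCommGroup.ofCore normedSpaceCore

instance : NormedSpace ℂ (OrliczSpace Φ μ) := NormedSpace.ofCore normedSpaceCore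

end OrliczSpace

end Orlicz

/-! ### Weighted translations -/

/-- A weight on `G`: a bounded continuous function `w : G → (0, ∞)`. -/
structure TranslationWeight (G : Type*) [TopologicalSpace G] where
  toFun : G → ℝ
  continuous' : Continuous toFun
  pos' : ∀ x, 0 < toFun x
  bounded' : ∃ C, ∀ x, toFun x ≤ C

instance (G : Type*) [TopologicalSpace G] : CoeFun (TranslationWeight G) (fun _ => G → ℝ) :=
  ⟨TranslationWeight.toFun⟩

section Translation

variable {G : Type*} [Group G] [TopologicalSpace G] [IsTopologicalGroup G] [MeasurableSpace G]
  [BorelSpace G] [SecondCountableTopology G]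

/-- The class of the function `x ↦ w x * f (x * a⁻¹)`, that is, of `w · (f ∗ δ_a)`. -/
def weightedTranslationAE (lam : Measure G) [lam.IsMulRightInvariant] (a : G)
    (w : TranslationWeight G) (f : G →ₘ[lam] ℂ) : G →ₘ[lam] ℂ :=
  AEEqFun.mk (fun x => (w x : ℂ))
      (Complex.continuous_ofReal.comp w.continuous').measurable.aestronglyMeasurable *
    f.compMeasurePreserving (fun x => x * a⁻¹) (measurePreserving_mul_right lam a⁻¹)

theorem coeFn_weightedTranslationAE (lam : Measure G) [lam.IsMulRightInvariant] (a : G)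
    (w : TranslationWeight G) (f : G →ₘ[lam] ℂ) :
    weightedTranslationAE lam a w f =ᵐ[lam] fun x => (w x : ℂ) * f (x * a⁻¹) := by
  refine (AEEqFun.coeFn_mul _ _).trans ?_
  filter_upwards [AEEqFun.coeFn_mk (fun x => (w x : ℂ))
      (Complex.continuous_ofReal.comp w.continuous').measurable.aestronglyMeasurable (μ := lam),
    AEEqFun.coeFn_compMeasurePreserving f (measurePreserving_mul_right lam a⁻¹)] with x h1 h2
  rw [Pi.mul_apply, h1, h2]
  rfl

theorem orliczModular_weightedTranslationAE_le (Φ : YoungFunction) (lam : Measure G)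
    [lam.IsMulRightInvariant] (a : G) (w : TranslationWeight G) (f : G →ₘ[lam] ℂ) {C k : ℝ}
    (hC : 0 < C) (hw : ∀ x, w x ≤ C) (hk : 0 < k) :
    orliczModular Φ lam (weightedTranslationAE lam a w f) (C * k) ≤ orliczModular Φ lam f k := by
  have h1 : orliczModular Φ lam (weightedTranslationAE lam a w f) (C * k) ≤
      orliczModular Φ lam (fun x => f (x * a⁻¹)) k := by
    refine orliczModular_le_of_norm_le hk hC ?_
    filter_upwards [coeFn_weightedTranslationAE lam a w f] with x hx
    rw [hx, norm_mul, Complex.norm_of_nonneg (w.pos' x).le]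
    gcongr
    exact hw x
  refine h1.trans (le_of_eq ?_)
  exact (measurePreserving_mul_right lam a⁻¹).lintegral_comp
    (f := fun x => ENNReal.ofReal (Φ (‖f x‖ / k)))
    ((Φ.measurable.comp (f.measurable.norm.div_const k)).ennreal_ofReal)

theorem exists_bound_weight (w : TranslationWeight G) : ∃ C, 0 < C ∧ ∀ x, w x ≤ C := by
  obtain ⟨C, hC⟩ := w.bounded'
  exact ⟨C, (w.pos' 1).trans_le (hC 1), hC⟩

theorem weightedTranslationAE_mem {Φ : YoungFunction} {lam : Measure G}
    [lam.IsMulRightInvariant] (a : G) (w : TranslationWeight G) {f : G →ₘ[lam] ℂ}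
    (hf : f ∈ OrliczSpace Φ lam) : weightedTranslationAE lam a w f ∈ OrliczSpace Φ lam := by
  obtain ⟨C, hC, hw⟩ := exists_bound_weight w
  obtain ⟨b, hb, h⟩ := hf
  have h1 := orliczModular_weightedTranslationAE_le Φ lam a w f hC hw (inv_pos.2 hb)
  simp only [orliczModular, div_eq_inv_mul, inv_inv] at h1
  exact ⟨(C * b⁻¹)⁻¹, by positivity, h1.trans_lt h⟩

/-- The weighted translation operator `T_{a,w} f = w · (f ∗ δ_a)`, i.e.
`(T_{a,w} f)(x) = w x * f (x * a⁻¹)`, as a bounded linear operator on `L^Φ(G)`. -/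
def weightedTranslation (Φ : YoungFunction) (lam : Measure G) [lam.IsMulRightInvariant] (a : G)
    (w : TranslationWeight G) : OrliczSpace Φ lam →L[ℂ] OrliczSpace Φ lam :=
  LinearMap.mkContinuousOfExistsBound
    { toFun := fun f => ⟨weightedTranslationAE lam a w f, weightedTranslationAE_mem a w f.2⟩
      map_add' := by
        intro f g
        apply Subtype.ext
        apply AEEqFun.ext
        have hadd := (measurePreserving_mul_right lam a⁻¹).quasiMeasurePreserving.ae_eq_comp
          (AEEqFun.coeFn_add (f : G →ₘ[lam] ℂ) g)
        refine (coeFn_weightedTranslationAE lam a w _).trans ?_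
        refine EventuallyEq.trans ?_ (AEEqFun.coeFn_add _ _).symm
        filter_upwards [hadd, coeFn_weightedTranslationAE lam a w (f : G →ₘ[lam] ℂ),
          coeFn_weightedTranslationAE lam a w (g : G →ₘ[lam] ℂ)] with x h1 h2 h3
        simp only [Function.comp_apply, Pi.add_apply] at h1
        rw [Submodule.coe_add, h1, Pi.add_apply, h2, h3, mul_add]
      map_smul' := by
        intro c f
        apply Subtype.ext
        apply AEEqFun.ext
        have hsmul := (measurePreserving_mul_right lam a⁻¹).quasiMeasurePreserving.ae_eq_comp
          (AEEqFun.coeFn_smul c (f : G →ₘ[lam] ℂ))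
        refine (coeFn_weightedTranslationAE lam a w _).trans ?_
        refine EventuallyEq.trans ?_ (AEEqFun.coeFn_smul _ _).symm
        filter_upwards [hsmul, coeFn_weightedTranslationAE lam a w (f : G →ₘ[lam] ℂ)] with x h1 h2
        simp only [Function.comp_apply, Pi.smul_apply] at h1
        rw [Submodule.coe_smul, h1, Pi.smul_apply, RingHom.id_apply, h2, smul_eq_mul, smul_eq_mul]
        ring }
    (by
      obtain ⟨C, hC, hw⟩ := exists_bound_weight w
      exact ⟨C, fun f => luxemburgNorm_le_of_modular_le hC (OrliczSpace.exists_modular_le_one f)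
        fun k hk => orliczModular_weightedTranslationAE_le Φ lam a w f hC hw hk⟩)

end Translation

/-- An element `a` is aperiodic if the closed subgroup generated by `a` is not compact. -/
def IsAperiodic {G : Type*} [Group G] [TopologicalSpace G] [IsTopologicalGroup G] (a : G) : Prop :=
  ¬ IsCompact ((Subgroup.zpowers a).topologicalClosure : Set G)

/-- `φ_n = ∏_{j=1}^n w ∗ δ_{a⁻¹}^j`, that is, `φ_n(x) = ∏_{j=1}^n w(x a^j)`. -/
def weightProd {G : Type*} [Group G] (a : G) (w : G → ℝ) (n : ℕ) (x : G) : ℝ :=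
  ∏ j ∈ Finset.Icc 1 n, w (x * a ^ j)

/-- `φ̃_n = (∏_{j=0}^{n-1} w ∗ δ_a^j)⁻¹`, that is, `φ̃_n(x) = (∏_{j=0}^{n-1} w(x a^{-j}))⁻¹`. -/
def weightProdTilde {G : Type*} [Group G] (a : G) (w : G → ℝ) (n : ℕ) (x : G) : ℝ :=
  (∏ j ∈ Finset.range n, w (x * (a ^ j)⁻¹))⁻¹

/-- The operators `T_1, …, T_L` are disjoint topologically mixing: for all nonempty open sets
`U, V_1, …, V_L`, the set `U ∩ T_1^{-n}(V_1) ∩ ⋯ ∩ T_L^{-n}(V_L)` is nonempty from some `n`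
onwards. -/
def DisjointTopologicallyMixing {X : Type*} [NormedAddCommGroup X] [NormedSpace ℂ X] {L : ℕ}
    (T : Fin L → X →L[ℂ] X) : Prop :=
  ∀ (U : Set X) (V : Fin L → Set X), IsOpen U → U.Nonempty →
    (∀ l, IsOpen (V l)) → (∀ l, (V l).Nonempty) →
    ∃ N : ℕ, ∀ n ≥ N, (U ∩ ⋂ l, (T l ^ n) ⁻¹' V l).Nonempty

/-- The supremum norm `‖h|_E‖_∞` of the restriction of `h` to `E` in `L^∞(E)`. -/
def supNormOn {G : Type*} [MeasurableSpace G] (lam : Measure G) (h : G → ℝ) (E : Set G) : ℝ≥0∞ :=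
  eLpNorm h ∞ (lam.restrict E)

end

/-! The iterates satisfy `T_l^m f(x) = f(x a⁻ᵐ) / φ̃_{l,m}(x)`, and on bounded functions of compact
support `S_l^m F(x) = φ̃_{l,m}(x aᵐ) F(x aᵐ)` is a right inverse of `T_l^m`. Up to a translation,
which leaves the Luxemburg norm unchanged because the measure is right invariant, each operator
below is multiplication by one of the functions in (ii): `T_l^{r_l n}` by `φ_{l,r_l n}`, `S_l^{r_l
n}` by `φ̃_{l,r_l n}`, and `T_l^{r_l n} S_s^{r_s n}`, `s ≠ l`, by one of the two quotients,
according to the order of `s` and `l`. The cocycle identity `weightProdTilde_add` turns one form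
into the other.

(ii) implies (i). By the `Δ₂` condition, bounded functions of compact support are dense
(`denseRange_boundedCompactToOrlicz`), so it is enough to move near such targets. Given `F` and
`H_1, …, H_L` vanishing off `K`, the vectors `v_n = F 1_{E_n} + ∑ S_s^{r_s n}(H_s 1_{E_n})` tend to
`F`. In `T_l^{r_l n} v_n` the diagonal term is `H_l 1_{E_n}`, which tends to `H_l`, and every other
term tends to `0`.

(i) implies (ii). Mixing yields, for all large `n`, a vector `v` such that `v` and every `T_l^{r_l
n} v` are close to the indicator of `K` in norm, hence pointwise close off a set of small measure
(`OrliczSpace.measure_ge_le`). By aperiodicity (`IsAperiodic.eventually_mul_zpow_notMem`) the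
relevant translates of a point of `K` lie outside `K` for large `n`, where these functions are small
rather than near `1`. Each weight expression is a ratio `c / d` with `c z` small and `d z` near `1`
for a single value `z` of `v`, so it is small. Removing the translates of the bad sets from `K`
leaves `E_n`, and a diagonal choice sends the tolerance to `0`. -/

noncomputable section

/-! ### Powers of an aperiodic element -/

section Aperiodic

open scoped Pointwise

variable {G : Type*} [Group G] [TopologicalSpace G] [IsTopologicalGroup G]

/-- If the powers of `a` meet a compact set for infinitely many exponents, then they return to
every neighbourhood of `1` for arbitrarily large exponents. -/
theorem exists_zpow_mem_nhds_one_of_infinite {a : G} {C : Set G} (hC : IsCompact C)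
    (hinf : {n : ℤ | a ^ n ∈ C}.Infinite) {U : Set G} (hU : U ∈ 𝓝 (1 : G)) (N : ℤ) :
    ∃ n : ℤ, N ≤ n ∧ a ^ n ∈ U := by
  have hU' : U ∩ U⁻¹ ∈ 𝓝 (1 : G) := inter_mem hU (inv_mem_nhds_one G hU)
  obtain ⟨V, hV, hVU⟩ : ∃ V ∈ 𝓝 (1 : G), ∀ v ∈ V, ∀ w ∈ V, v⁻¹ * w ∈ U ∩ U⁻¹ := by
    have hc : Tendsto (fun p : G × G => p.1⁻¹ * p.2) (𝓝 1 ×ˢ 𝓝 1) (𝓝 1) := by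
      have : Continuous fun p : G × G => p.1⁻¹ * p.2 := by fun_prop
      simpa [nhds_prod_eq] using this.tendsto ((1 : G), (1 : G))
    obtain ⟨V, hV, h⟩ := (mem_prod_same_iff.1 (hc hU'))
    exact ⟨V, hV, fun v hv w hw => h (Set.mk_mem_prod hv hw)⟩
  obtain ⟨t, -, ht⟩ := hC.elim_nhds_subcover (fun x => x • V)
    (fun x _ => by simpa using smul_mem_nhds_smul x hV)
  -- Pigeonhole: one of finitely many translates of `V` holds infinitely many powers of `a`, so it
  -- holds two whose exponents are at least `N` apart.
  have h1 : ∃ x ∈ t, {n : ℤ | a ^ n ∈ x • V}.Infinite := by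
    by_contra! h
    refine hinf ((t.finite_toSet.biUnion (t := fun x => {n : ℤ | a ^ n ∈ x • V}) h).subset ?_)
    intro n hn
    simpa using ht hn
  obtain ⟨x, -, hx⟩ := h1
  obtain ⟨n, hn⟩ := hx.nonempty
  obtain ⟨m, hm, hmn⟩ : ∃ m ∈ {n : ℤ | a ^ n ∈ x • V}, N ≤ |m - n| := by
    by_contra! h
    refine hx ((Set.finite_Icc (n - |N|) (n + |N|)).subset fun m hm => ?_)
    have h2 := (h m hm).trans_le (le_abs_self N)
    rw [abs_lt] at h2
    constructor <;> linarith
  have key : ∀ p q : ℤ, a ^ p ∈ x • V → a ^ q ∈ x • V → a ^ (q - p) ∈ U ∩ U⁻¹ := by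
    intro p q hp hq
    have := hVU _ (Set.mem_smul_set_iff_inv_smul_mem.1 hp) _
      (Set.mem_smul_set_iff_inv_smul_mem.1 hq)
    have h3 : a ^ (q - p) = (a ^ p)⁻¹ * a ^ q := by
      rw [← zpow_neg, ← zpow_add]; congr 1; ring
    simpa [mul_assoc, h3] using this
  refine ⟨|m - n|, hmn, ?_⟩
  -- The two exponents play symmetric roles, so the sign of the difference is free.
  rcases abs_choice (m - n) with h | h <;> rw [h]
  · exact (key n m hn hm).1
  · rw [neg_sub]
    exact (key m n hm hn).1

/-- The powers of an aperiodic element of a locally compact group leave every compact set. -/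
theorem IsAperiodic.finite_zpow_mem [LocallyCompactSpace G] {a : G}
    (ha : IsAperiodic a) {C : Set G} (hC : IsCompact C) : {n : ℤ | a ^ n ∈ C}.Finite := by
  by_contra hinf
  refine ha ?_
  obtain ⟨V, hVc, hV⟩ := exists_compact_mem_nhds (1 : G)
  obtain ⟨W, hWV, hWo, h1⟩ := mem_nhds_iff.1 hV
  set H : Set G := ((Subgroup.zpowers a).topologicalClosure : Set G) with hH
  -- Some power `aᵐ` approximates `h` by density. Since powers with arbitrarily large exponents
  -- return near `1`, the exponent `m` can be replaced by one as large as desired.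
  have hcover : ∀ h ∈ H, ∀ N : ℤ, ∃ n : ℤ, N ≤ n ∧ (a ^ n)⁻¹ * h ∈ W := by
    intro h hh N
    have hS : IsOpen {g : G | g⁻¹ * h ∈ W} :=
      hWo.preimage (by fun_prop : Continuous fun g : G => g⁻¹ * h)
    rw [hH, Subgroup.topologicalClosure_coe] at hh
    obtain ⟨_, hg, ⟨m, rfl⟩⟩ := mem_closure_iff.1 hh _ hS (by simpa using h1)
    have hR : {g : G | (a ^ m * g)⁻¹ * h ∈ W} ∈ 𝓝 (1 : G) :=
      (hWo.preimage (by fun_prop : Continuous fun g : G => (a ^ m * g)⁻¹ * h)).mem_nhds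
        (by simpa using hg)
    obtain ⟨n, hn, hnW⟩ := exists_zpow_mem_nhds_one_of_infinite hC hinf hR (N - m)
    refine ⟨m + n, by linarith, ?_⟩
    rwa [zpow_add]
  have hcover' : ∀ h ∈ H, ∀ N : ℤ, ∃ n : ℤ, N ≤ n ∧ a ^ n * h ∈ W := by
    intro h hh N
    have hS : IsOpen {g : G | g⁻¹ * h ∈ W} :=
      hWo.preimage (by fun_prop : Continuous fun g : G => g⁻¹ * h)
    rw [hH, Subgroup.topologicalClosure_coe] at hh
    obtain ⟨_, hg, ⟨m, rfl⟩⟩ := mem_closure_iff.1 hh _ hS (by simpa using h1)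
    have hR : {g : G | g * ((a ^ m)⁻¹ * h) ∈ W} ∈ 𝓝 (1 : G) :=
      (hWo.preimage (by fun_prop : Continuous fun g : G => g * ((a ^ m)⁻¹ * h))).mem_nhds
        (by simpa using hg)
    obtain ⟨n, hn, hnW⟩ := exists_zpow_mem_nhds_one_of_infinite hC hinf hR (N + m)
    refine ⟨n - m, by linarith, ?_⟩
    rw [zpow_sub, mul_assoc]
    exact hnW
  have hclosed : IsClosed H := Subgroup.isClosed_topologicalClosure _
  have hVH : IsCompact (V ∩ H) := hVc.inter_right hclosed
  -- The exponents `n + 1` are positive, which makes the descent below strict.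
  obtain ⟨t, ht⟩ := hVH.elim_finite_subcover (fun n : ℕ => {h : G | a ^ (n + 1) * h ∈ W})
    (fun n => hWo.preimage (by fun_prop)) (by
      rintro h ⟨-, hh⟩
      obtain ⟨n, hn, hnW⟩ := hcover' h hh 1
      lift n to ℕ using by linarith
      refine Set.mem_iUnion.2 ⟨n - 1, ?_⟩
      have : n - 1 + 1 = n := by omega
      simpa [this] using hnW)
  obtain ⟨M, hM⟩ : ∃ M, ∀ i ∈ t, i < M := ⟨t.sup id + 1, fun i hi =>
    Nat.lt_succ_of_le (Finset.le_sup (f := id) hi)⟩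
  have hpow : ∀ n : ℤ, a ^ n ∈ (Subgroup.zpowers a).topologicalClosure := fun n =>
    Subgroup.le_topologicalClosure _ ⟨n, rfl⟩
  have hsub : H ⊆ ⋃ n ∈ Finset.range (M + 1), (fun x => a ^ n * x) '' V := by
    intro h hh
    have hex : ∃ n : ℕ, (a ^ n)⁻¹ * h ∈ W := by
      obtain ⟨n, hn, hnW⟩ := hcover h hh 0
      lift n to ℕ using hn
      exact ⟨n, by simpa using hnW⟩
    classical
    -- Take the least `n ≥ 0` with `a⁻ⁿ h ∈ W`. This point of `V ∩ H` returns to `W` after `i + 1`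
    -- further steps for some `i < M`; if `i + 1 ≤ n`, that would contradict minimality. Hence `n`
    -- is bounded and finitely many translates of `V` cover `H`.
    set n := Nat.find hex with hn
    have hnW : (a ^ n)⁻¹ * h ∈ W := Nat.find_spec hex
    have hnH : (a ^ n)⁻¹ * h ∈ H := by
      refine (Subgroup.topologicalClosure _).mul_mem (Subgroup.inv_mem _ ?_) hh
      simpa using hpow n
    have h2 := ht ⟨hWV hnW, hnH⟩
    simp only [Set.mem_iUnion, Set.mem_ofPred_eq, exists_prop] at h2
    obtain ⟨i, hi, hiW⟩ := h2
    have hlt : n < i + 1 := by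
      by_contra! hle
      refine Nat.find_min hex (m := n - (i + 1)) (by omega) ?_
      have h3 : (a ^ (n - (i + 1)))⁻¹ * h = a ^ (i + 1) * ((a ^ n)⁻¹ * h) := by
        rw [← mul_assoc]
        congr 1
        have : a ^ n = a ^ (n - (i + 1)) * a ^ (i + 1) := by rw [← pow_add]; congr 1; omega
        rw [this]; group
      rwa [h3]
    have := hM i hi
    refine Set.mem_biUnion (x := n) (by simp; omega) ⟨_, hWV hnW, by simp⟩
  refine IsCompact.of_isClosed_subset ?_ hclosed hsub
  exact (Finset.range (M + 1)).isCompact_biUnion fun n _ => hVc.image (by fun_prop)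

/-- If `a` is aperiodic and `K` is compact, then `K` and `K * a ^ n` are disjoint as soon as `|n|`
is large. -/
theorem IsAperiodic.eventually_mul_zpow_notMem [LocallyCompactSpace G] {a : G}
    (ha : IsAperiodic a) {K : Set G} (hK : IsCompact K) :
    ∃ N : ℕ, ∀ n : ℤ, (N : ℤ) ≤ |n| → ∀ x ∈ K, x * a ^ n ∉ K := by
  have hC : IsCompact ((fun p : G × G => p.1⁻¹ * p.2) '' (K ×ˢ K)) :=
    (hK.prod hK).image (by fun_prop)
  obtain ⟨N, hN⟩ := ((ha.finite_zpow_mem hC).image Int.natAbs).bddAbove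
  refine ⟨N + 1, fun n hn x hx hxn => ?_⟩
  have : n.natAbs ≤ N := hN ⟨n, ⟨(x, x * a ^ n), ⟨hx, hxn⟩, by simp⟩, rfl⟩
  rw [Int.abs_eq_natAbs] at hn
  omega

theorem IsAperiodic.noncompactSpace {a : G} (ha : IsAperiodic a) : ¬ CompactSpace G := fun _ =>
  ha (Subgroup.isClosed_topologicalClosure _).isCompact

end Aperiodic

/-! ### Products of weights along an orbit -/

section Products

variable {G : Type*} [Group G]

theorem weightProdTilde_pos (a : G) {w : G → ℝ} (hw : ∀ x, 0 < w x) (n : ℕ) (x : G) :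
    0 < weightProdTilde a w n x := inv_pos.2 (Finset.prod_pos fun _ _ => hw _)

theorem weightProd_pos (a : G) {w : G → ℝ} (hw : ∀ x, 0 < w x) (n : ℕ) (x : G) :
    0 < weightProd a w n x := Finset.prod_pos fun _ _ => hw _

theorem weightProdTilde_add (a : G) (w : G → ℝ) (m k : ℕ) (x : G) :
    weightProdTilde a w (m + k) x =
      weightProdTilde a w m x * weightProdTilde a w k (x * (a ^ m)⁻¹) := by
  unfold weightProdTilde
  rw [← mul_inv, Finset.prod_range_add]
  congr 2
  refine Finset.prod_congr rfl fun j _ => ?_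
  rw [mul_assoc, ← mul_inv_rev, ← pow_add, add_comm m, pow_add]

theorem weightProd_eq_prod_range (a : G) (w : G → ℝ) (n : ℕ) (x : G) :
    weightProd a w n x = ∏ j ∈ Finset.range n, w (x * a ^ (j + 1)) := by
  unfold weightProd
  rw [Finset.range_eq_Ico, Finset.prod_Ico_add' (fun j => w (x * a ^ j)) 0 n 1]
  rfl

/-- The factors read backwards from `x aᵐ` are those read forwards from `x`, in reverse order. -/
theorem weightProdTilde_mul_pow (a : G) (w : G → ℝ) (m : ℕ) (x : G) :
    weightProdTilde a w m (x * a ^ m) = (weightProd a w m x)⁻¹ := by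
  unfold weightProdTilde
  rw [weightProd_eq_prod_range, ← Finset.prod_range_reflect]
  congr 1
  refine Finset.prod_congr rfl fun j hj => ?_
  have hj := Finset.mem_range.1 hj
  congr 1
  rw [mul_assoc]
  congr 1
  have : a ^ m = a ^ (j + 1) * a ^ (m - 1 - j) := by rw [← pow_add]; congr 1; omega
  rw [this, mul_inv_cancel_right]

theorem weightProdTilde_add_mul_pow (a : G) (w : G → ℝ) (m k : ℕ) (x : G) :
    weightProdTilde a w (m + k) (x * a ^ m) =
      (weightProd a w m x)⁻¹ * weightProdTilde a w k x := by
  rw [weightProdTilde_add, weightProdTilde_mul_pow, mul_inv_cancel_right]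

/-- The backward orbit of length `m` from `x a^(m-k)` splits at `x`. This and the next identity are
the source of the quotients in the disjointness conditions. -/
theorem inv_weightProdTilde_mul_pow_sub (a : G) (w : G → ℝ) {m k : ℕ} (h : k ≤ m) (x : G) :
    (weightProdTilde a w m (x * a ^ (m - k)))⁻¹ =
      weightProd a w (m - k) x / weightProdTilde a w k x := by
  have := weightProdTilde_add_mul_pow a w (m - k) k x
  rw [Nat.sub_add_cancel h] at this
  rw [this, mul_inv, inv_inv, div_eq_mul_inv]

theorem inv_weightProdTilde_mul_inv_pow_sub (a : G) {w : G → ℝ} (hw : ∀ x, 0 < w x) {m k : ℕ}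
    (h : k ≤ m) (x : G) :
    (weightProdTilde a w k (x * (a ^ (m - k))⁻¹))⁻¹ =
      weightProdTilde a w (m - k) x / weightProdTilde a w m x := by
  have := weightProdTilde_add a w (m - k) k x
  rw [Nat.sub_add_cancel h] at this
  rw [this, div_mul_cancel_left₀ (weightProdTilde_pos a hw _ _).ne']

variable [TopologicalSpace G] [IsTopologicalGroup G]

theorem continuous_weightProdTilde (a : G) {w : G → ℝ} (hw : Continuous w) (hpos : ∀ x, 0 < w x)
    (n : ℕ) : Continuous (weightProdTilde a w n) := by
  refine Continuous.inv₀ (continuous_finsetProd _ fun j _ => by fun_prop) fun x => ?_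
  exact (Finset.prod_pos fun _ _ => hpos _).ne'

end Products

/-! ### Iterates of a weighted translation -/

section Powers

variable {G : Type*} [Group G] [TopologicalSpace G] [IsTopologicalGroup G] [MeasurableSpace G]
  [BorelSpace G] [SecondCountableTopology G]

theorem coeFn_weightedTranslation (Φ : YoungFunction) (lam : Measure G)
    [lam.IsMulRightInvariant] (a : G) (w : TranslationWeight G) (f : OrliczSpace Φ lam) :
    ((weightedTranslation Φ lam a w f : OrliczSpace Φ lam) : G →ₘ[lam] ℂ) =ᵐ[lam]
      fun x => (w x : ℂ) * (f : G →ₘ[lam] ℂ) (x * a⁻¹) :=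
  coeFn_weightedTranslationAE lam a w f

theorem coeFn_weightedTranslation_pow (Φ : YoungFunction) (lam : Measure G)
    [lam.IsMulRightInvariant] (a : G) (w : TranslationWeight G) (n : ℕ) (f : OrliczSpace Φ lam) :
    (((weightedTranslation Φ lam a w ^ n) f : OrliczSpace Φ lam) : G →ₘ[lam] ℂ) =ᵐ[lam]
      fun x => (((weightProdTilde a w n x)⁻¹ : ℝ) : ℂ) * (f : G →ₘ[lam] ℂ) (x * (a ^ n)⁻¹) := by
  induction n with
  | zero => simp [weightProdTilde]
  | succ n ih =>
    rw [pow_succ', mul_apply_eq_comp]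
    have ih' := (measurePreserving_mul_right lam a⁻¹).quasiMeasurePreserving.ae_eq_comp ih
    filter_upwards [coeFn_weightedTranslation Φ lam a w ((weightedTranslation Φ lam a w ^ n) f),
      ih'] with x h1 h2
    simp only [Function.comp_apply] at h2
    rw [h1, h2, add_comm n 1, weightProdTilde_add]
    simp only [weightProdTilde, Finset.prod_range_one, pow_zero, inv_one, mul_one, pow_one, inv_inv,
      mul_inv, mul_assoc, Complex.ofReal_mul, pow_add, mul_inv_rev]
    rw [← mul_inv_rev, ← mul_inv_rev, ← pow_succ, ← pow_succ']

end Powers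

/-! ### Bounded functions of compact support in the Orlicz space -/

theorem OrliczSpace.tendsto_zero_of_modular {α ι : Type*} [MeasurableSpace α] {Φ : YoungFunction}
    {μ : Measure α} {l : Filter ι} {f : ι → OrliczSpace Φ μ}
    (h : ∀ k : ℝ, 0 < k → ∀ᶠ n in l, orliczModular Φ μ (f n : α →ₘ[μ] ℂ) k ≤ 1) :
    Tendsto f l (𝓝 0) := by
  rw [tendsto_zero_iff_norm_tendsto_zero, Metric.tendsto_nhds]
  intro ε hε
  filter_upwards [h (ε / 2) (by positivity)] with n hn
  rw [Real.dist_0_eq_abs, abs_of_nonneg (norm_nonneg _)]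
  exact (luxemburgNorm_le (by positivity) hn).trans_lt (by linarith)

section CompactSupport

variable {G : Type*} [TopologicalSpace G] [MeasurableSpace G]

/-- The bounded measurable functions that vanish outside a compact set. -/
def boundedCompact (G : Type*) [TopologicalSpace G] [MeasurableSpace G] :
    Submodule ℂ (G → ℂ) where
  carrier := {F | Measurable F ∧ (∃ C, ∀ x, ‖F x‖ ≤ C) ∧ ∃ K, IsCompact K ∧ ∀ x ∉ K, F x = 0}
  zero_mem' := ⟨measurable_const, ⟨0, by simp⟩, ∅, isCompact_empty, by simp⟩
  add_mem' := by
    rintro f g ⟨hf, ⟨C, hC⟩, K, hK, hfK⟩ ⟨hg, ⟨D, hD⟩, K', hK', hgK⟩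
    refine ⟨hf.add hg, ⟨C + D, fun x => (norm_add_le _ _).trans (add_le_add (hC x) (hD x))⟩,
      K ∪ K', hK.union hK', fun x hx => ?_⟩
    rw [Set.mem_union, not_or] at hx
    simp [hfK x hx.1, hgK x hx.2]
  smul_mem' := by
    rintro c f ⟨hf, ⟨C, hC⟩, K, hK, hfK⟩
    refine ⟨hf.const_smul c, ⟨‖c‖ * C, fun x => ?_⟩, K, hK, fun x hx => by simp [hfK x hx]⟩
    rw [Pi.smul_apply, norm_smul]
    exact mul_le_mul_of_nonneg_left (hC x) (norm_nonneg c)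

theorem lintegral_young_lt_top (Φ : YoungFunction) {lam : Measure G} [IsFiniteMeasureOnCompacts lam]
    {F : G → ℂ} (hF : F ∈ boundedCompact G) :
    ∫⁻ x, ENNReal.ofReal (Φ (‖F x‖)) ∂lam < ∞ := by
  obtain ⟨hm, ⟨C, hC⟩, K, hK, hFK⟩ := hF
  calc ∫⁻ x, ENNReal.ofReal (Φ (‖F x‖)) ∂lam
      ≤ ∫⁻ x, K.indicator (fun _ => ENNReal.ofReal (Φ C)) x ∂lam := by
        refine lintegral_mono fun x => ?_
        by_cases hx : x ∈ K
        · rw [Set.indicator_of_mem hx]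
          exact ENNReal.ofReal_le_ofReal (Φ.mono (norm_nonneg _) (hC x))
        · simp [hFK x hx, Φ.zero']
    _ ≤ ENNReal.ofReal (Φ C) * lam K := lintegral_indicator_const_le _ _
    _ < ∞ := ENNReal.mul_lt_top ENNReal.ofReal_lt_top hK.measure_lt_top

/-- The inclusion of the bounded measurable functions of compact support into the Orlicz space. -/
def boundedCompactToOrlicz (Φ : YoungFunction) (lam : Measure G) [IsFiniteMeasureOnCompacts lam] :
    boundedCompact G →ₗ[ℂ] OrliczSpace Φ lam where
  toFun F := ⟨AEEqFun.mk F F.2.1.aestronglyMeasurable, 1, one_pos, by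
    refine lt_of_eq_of_lt (lintegral_congr_ae ?_) (lintegral_young_lt_top Φ (lam := lam) F.2)
    filter_upwards [AEEqFun.coeFn_mk (F : G → ℂ) F.2.1.aestronglyMeasurable (μ := lam)] with x hx
    rw [hx, one_mul]⟩
  map_add' _ _ := rfl
  map_smul' _ _ := rfl

theorem coeFn_boundedCompactToOrlicz (Φ : YoungFunction) (lam : Measure G)
    [IsFiniteMeasureOnCompacts lam] (F : boundedCompact G) :
    ((boundedCompactToOrlicz Φ lam F : OrliczSpace Φ lam) : G →ₘ[lam] ℂ) =ᵐ[lam] F :=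
  AEEqFun.coeFn_mk _ _

/-- Restriction of a function to a measurable set. -/
def boundedCompactIndicator (E : Set G) (hE : MeasurableSet E) :
    boundedCompact G →ₗ[ℂ] boundedCompact G where
  toFun F := ⟨E.indicator F, by
    obtain ⟨hm, ⟨C, hC⟩, K, hK, hFK⟩ := F.2
    refine ⟨hm.indicator hE, ⟨C, fun x => (norm_indicator_le_norm_self _ x).trans (hC x)⟩,
      K, hK, fun x hx => ?_⟩
    exact Set.indicator_apply_eq_zero.2 fun _ => hFK x hx⟩
  map_add' _ _ := Subtype.ext (Set.indicator_add _ _ _)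
  map_smul' c F := Subtype.ext (Set.indicator_const_smul _ c (F : G → ℂ))

/-- The difference is bounded by `C` and lives on `K \ E n`, so its modular at scale `k` is at most
`Φ (C / k) * lam (K \ E n)`. -/
theorem tendsto_boundedCompactIndicator (Φ : YoungFunction) (lam : Measure G)
    [IsFiniteMeasureOnCompacts lam] (F : boundedCompact G) {K : Set G}
    (hFK : ∀ x ∉ K, (F : G → ℂ) x = 0) {E : ℕ → Set G} (hE : ∀ n, MeasurableSet (E n))
    (h : Tendsto (fun n => lam (K \ E n)) atTop (𝓝 0)) :
    Tendsto (fun n => boundedCompactToOrlicz Φ lam (boundedCompactIndicator (E n) (hE n) F)) atTop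
      (𝓝 (boundedCompactToOrlicz Φ lam F)) := by
  obtain ⟨-, ⟨C, hC⟩, -⟩ := F.2
  rw [← tendsto_sub_nhds_zero_iff]
  simp only [← map_sub]
  refine OrliczSpace.tendsto_zero_of_modular fun k hk => ?_
  have h1 : Tendsto (fun n => ENNReal.ofReal (Φ (C / k)) * lam (K \ E n)) atTop (𝓝 0) := by
    simpa using ENNReal.Tendsto.const_mul h (Or.inr ENNReal.ofReal_ne_top)
  filter_upwards [h1.eventually (ge_mem_nhds one_pos)] with n hn
  refine le_trans ?_ hn
  rw [orliczModular_congr (coeFn_boundedCompactToOrlicz Φ lam _)]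
  refine le_trans (lintegral_mono fun x => ?_) (lintegral_indicator_const_le _ _)
  have hx : ((boundedCompactIndicator (E n) (hE n) F - F : boundedCompact G) : G → ℂ) x =
    (E n).indicator F x - (F : G → ℂ) x := rfl
  rw [hx]
  by_cases hxE : x ∈ E n
  · simp [hxE, Φ.zero']
  · by_cases hxK : x ∈ K
    · rw [Set.indicator_of_mem (show x ∈ K \ E n from ⟨hxK, hxE⟩), Set.indicator_of_notMem hxE,
        zero_sub, norm_neg]
      refine ENNReal.ofReal_le_ofReal (Φ.mono (by positivity) ?_)
      gcongr
      exact hC x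
    · simp [hxE, hFK x hxK, Φ.zero']

theorem YoungFunction.exists_pow_bound {Φ : YoungFunction} {M : ℝ} (hM : 0 < M)
    (h : ∀ t > 0, Φ (2 * t) ≤ M * Φ t) (c : ℝ) :
    ∃ D : ℝ, 0 < D ∧ ∀ t ≥ 0, Φ (c * t) ≤ D * Φ t := by
  have hpow : ∀ n : ℕ, ∀ t ≥ 0, Φ (2 ^ n * t) ≤ M ^ n * Φ t := by
    intro n
    induction n with
    | zero => simp
    | succ n ih =>
      intro t ht
      rcases ht.eq_or_lt with rfl | ht0
      · simp [Φ.zero']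
      · rw [pow_succ', pow_succ', mul_assoc, mul_assoc]
        exact (h _ (by positivity)).trans (mul_le_mul_of_nonneg_left (ih t ht) hM.le)
  obtain ⟨n, hn⟩ := pow_unbounded_of_one_lt |c| (one_lt_two (α := ℝ))
  refine ⟨M ^ n, by positivity, fun t ht => le_trans ?_ (hpow n t ht)⟩
  have habs : Φ (c * t) = Φ (|c| * t) := by
    rcases abs_choice c with h | h <;> rw [h]
    rw [neg_mul, Φ.even']
  rw [habs]
  exact Φ.mono (by positivity) (by gcongr)

/-- Truncate `f` both in size and to a compact exhaustion. Membership gives a finite modular at one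
scale only; the `Δ₂` condition transfers it to every scale `k`, and this provides the dominating
function for the convergence of the truncations. -/
theorem denseRange_boundedCompactToOrlicz [T2Space G] [LocallyCompactSpace G]
    [SecondCountableTopology G] [BorelSpace G] (Φ : YoungFunction) (lam : Measure G)
    [IsFiniteMeasureOnCompacts lam] {M : ℝ} (hM : 0 < M) (h : ∀ t > 0, Φ (2 * t) ≤ M * Φ t) :
    DenseRange (boundedCompactToOrlicz Φ lam) := by
  intro f
  set φ : G → ℂ := ((f : G →ₘ[lam] ℂ) : G → ℂ) with hφ
  have hφm : Measurable φ := (f : G →ₘ[lam] ℂ).measurable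
  let A : ℕ → Set G := fun n => compactCovering G n ∩ {x | ‖φ x‖ ≤ n}
  have hA : ∀ n, MeasurableSet (A n) := fun n =>
    (isCompact_compactCovering G n).measurableSet.inter (measurableSet_le hφm.norm measurable_const)
  have hmem : ∀ n, (A n).indicator φ ∈ boundedCompact G := fun n => by
    refine ⟨hφm.indicator (hA n), ⟨n, fun x => ?_⟩, _, isCompact_compactCovering G n,
      fun x hx => Set.indicator_of_notMem (fun hxA => hx hxA.1) _⟩
    by_cases hx : x ∈ A n
    · rw [Set.indicator_of_mem hx]; exact hx.2
    · simp [hx]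
  refine mem_closure_of_tendsto (f := fun n => boundedCompactToOrlicz Φ lam ⟨_, hmem n⟩)
    (b := atTop) ?_ (Eventually.of_forall fun n => ⟨_, rfl⟩)
  rw [← tendsto_sub_nhds_zero_iff]
  refine OrliczSpace.tendsto_zero_of_modular fun k hk => ?_
  obtain ⟨β, hβ, hfin⟩ := f.2
  obtain ⟨D, hD, hDt⟩ := YoungFunction.exists_pow_bound hM h (β⁻¹ / k)
  have hae : ∀ n, ((boundedCompactToOrlicz Φ lam ⟨_, hmem n⟩ - f : OrliczSpace Φ lam) :
      G →ₘ[lam] ℂ) =ᵐ[lam] fun x => (A n).indicator φ x - φ x := by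
    intro n
    filter_upwards [AEEqFun.coeFn_sub ((boundedCompactToOrlicz Φ lam ⟨_, hmem n⟩ :
      OrliczSpace Φ lam) : G →ₘ[lam] ℂ) f, coeFn_boundedCompactToOrlicz Φ lam ⟨_, hmem n⟩]
      with x h1 h2
    rw [Submodule.coe_sub, h1, Pi.sub_apply, h2]
  have hlim : Tendsto (fun n => orliczModular Φ lam (fun x => (A n).indicator φ x - φ x) k) atTop
      (𝓝 (∫⁻ _, 0 ∂lam)) := by
    refine tendsto_lintegral_of_dominated_convergence
      (fun x => ENNReal.ofReal D * ENNReal.ofReal (Φ (β * ‖φ x‖))) ?_ ?_ ?_ ?_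
    · intro n
      exact (Φ.measurable.comp (((hφm.indicator (hA n)).sub hφm).norm.div_const k)).ennreal_ofReal
    · intro n
      refine Eventually.of_forall fun x => ?_
      simp only
      rw [← ENNReal.ofReal_mul hD.le]
      refine ENNReal.ofReal_le_ofReal (le_trans (Φ.mono (by positivity) ?_)
        (hDt (β * ‖φ x‖) (by positivity)))
      have h1 : β⁻¹ / k * (β * ‖φ x‖) = ‖φ x‖ / k := by field_simp
      rw [h1]
      gcongr
      by_cases hx : x ∈ A n
      · simp [hx]
      · simp [hx]
    · rw [lintegral_const_mul' _ _ ENNReal.ofReal_ne_top]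
      exact ENNReal.mul_ne_top ENNReal.ofReal_ne_top hfin.ne
    · refine Eventually.of_forall fun x => tendsto_const_nhds.congr' ?_
      obtain ⟨N, hN⟩ := exists_mem_compactCovering x
      filter_upwards [eventually_ge_atTop N, eventually_ge_atTop ⌈‖φ x‖⌉₊] with n hn hn'
      have hx : x ∈ A n := ⟨compactCovering_subset G hn hN, Nat.ceil_le.1 hn'⟩
      simp [hx, Φ.zero']
  rw [lintegral_zero] at hlim
  filter_upwards [hlim.eventually (ge_mem_nhds one_pos)] with n hn
  rwa [orliczModular_congr (hae n)]

end CompactSupport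

/-! ### Weighted translations of bounded functions of compact support -/

section Translates

variable {G : Type*} [Group G] [TopologicalSpace G] [IsTopologicalGroup G] [MeasurableSpace G]
  [BorelSpace G] [SecondCountableTopology G]

/-- The operator `F ↦ (x ↦ c x * F (x * b))` on bounded functions of compact support. -/
def boundedCompactMulTranslate (c : G → ℝ) (hc : Continuous c) (b : G) :
    boundedCompact G →ₗ[ℂ] boundedCompact G where
  toFun F := ⟨fun x => (c x : ℂ) * (F : G → ℂ) (x * b), by
    obtain ⟨hm, ⟨C, hC⟩, K, hK, hFK⟩ := F.2
    have hK' : IsCompact ((fun x => x * b⁻¹) '' K) := hK.image (by fun_prop)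
    have hz : ∀ x ∉ (fun x => x * b⁻¹) '' K, (F : G → ℂ) (x * b) = 0 := fun x hx =>
      hFK _ fun hxK => hx ⟨x * b, hxK, by simp⟩
    obtain ⟨D, hD⟩ := hK'.exists_bound_of_continuousOn hc.continuousOn
    refine ⟨(Complex.continuous_ofReal.comp hc).measurable.mul (hm.comp (measurable_mul_const b)),
      ⟨|D| * C, fun x => ?_⟩, _, hK', fun x hx => by simp [hz x hx]⟩
    have hC0 : 0 ≤ C := (norm_nonneg _).trans (hC 1)
    by_cases hx : x ∈ (fun x => x * b⁻¹) '' K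
    · rw [norm_mul, Complex.norm_real]
      exact mul_le_mul ((hD x hx).trans (le_abs_self D)) (hC _) (norm_nonneg _) (abs_nonneg D)
    · simp only [hz x hx, mul_zero, norm_zero]
      positivity⟩
  map_add' F H := by
    ext x
    simp [mul_add]
  map_smul' k F := by
    ext x
    simp [mul_left_comm]

theorem weightedTranslation_pow_boundedCompactToOrlicz (Φ : YoungFunction) (lam : Measure G)
    [lam.IsMulRightInvariant] [IsFiniteMeasureOnCompacts lam] (a : G) (w : TranslationWeight G)
    (n : ℕ) (F : boundedCompact G) :
    (weightedTranslation Φ lam a w ^ n) (boundedCompactToOrlicz Φ lam F) =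
      boundedCompactToOrlicz Φ lam (boundedCompactMulTranslate
        (fun x => (weightProdTilde a w n x)⁻¹)
        ((continuous_weightProdTilde a w.continuous' w.pos' n).inv₀
          fun x => (weightProdTilde_pos a w.pos' n x).ne') (a ^ n)⁻¹ F) := by
  apply Subtype.ext
  apply AEEqFun.ext
  have h1 := (measurePreserving_mul_right lam (a ^ n)⁻¹).quasiMeasurePreserving.ae_eq_comp
    (coeFn_boundedCompactToOrlicz Φ lam F)
  filter_upwards [coeFn_weightedTranslation_pow Φ lam a w n (boundedCompactToOrlicz Φ lam F), h1,
    coeFn_boundedCompactToOrlicz Φ lam (boundedCompactMulTranslate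
        (fun x => (weightProdTilde a w n x)⁻¹)
        ((continuous_weightProdTilde a w.continuous' w.pos' n).inv₀
          fun x => (weightProdTilde_pos a w.pos' n x).ne') (a ^ n)⁻¹ F)] with x h2 h3 h4
  simp only [Function.comp_apply] at h3
  rw [h2, h3, h4]
  rfl

/-- If `|F_n|` is bounded by a translate of `h_n |H|` restricted to `E_n`, and `h_n` tends to zero
uniformly on `E_n`, then `F_n` tends to zero in the Orlicz space. -/
theorem tendsto_zero_of_supNormOn (Φ : YoungFunction) (lam : Measure G)
    [lam.IsMulRightInvariant] [IsFiniteMeasureOnCompacts lam] {F : ℕ → boundedCompact G}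
    (H : boundedCompact G) {h : ℕ → G → ℝ} {E : ℕ → Set G} (hE : ∀ n, MeasurableSet (E n))
    (b : ℕ → G)
    (hF : ∀ n x, x * b n ∉ E n → (F n : G → ℂ) x = 0)
    (hF' : ∀ n x, ‖(F n : G → ℂ) x‖ ≤ ‖h n (x * b n)‖ * ‖(H : G → ℂ) (x * b n)‖)
    (hh : Tendsto (fun n => supNormOn lam (h n) (E n)) atTop (𝓝 0)) :
    Tendsto (fun n => boundedCompactToOrlicz Φ lam (F n)) atTop (𝓝 0) := by
  refine OrliczSpace.tendsto_zero_of_modular fun k hk => ?_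
  obtain ⟨l, hl, hHl⟩ := OrliczSpace.exists_modular_le_one (boundedCompactToOrlicz Φ lam H)
  rw [orliczModular_congr (coeFn_boundedCompactToOrlicz Φ lam H)] at hHl
  -- The threshold `k / l` turns the scale `l`, at which `H` has modular at most `1`, into the scale
  -- `k` for `F n`.
  have hkl : 0 < ENNReal.ofReal (k / l) := ENNReal.ofReal_pos.2 (by positivity)
  filter_upwards [hh.eventually (ge_mem_nhds hkl)] with n hn
  have h1 : ∀ᵐ x ∂lam, x ∈ E n → ‖h n x‖ ≤ k / l := by
    rw [← ae_restrict_iff' (hE n)]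
    rw [supNormOn, eLpNorm_exponent_top] at hn
    filter_upwards [ae_le_eLpNormEssSup (f := h n) (μ := lam.restrict (E n))] with x hx
    have := hx.trans hn
    rwa [← ofReal_norm, ENNReal.ofReal_le_ofReal_iff (by positivity)] at this
  have h2 := (measurePreserving_mul_right lam (b n)).quasiMeasurePreserving.ae h1
  rw [orliczModular_congr (coeFn_boundedCompactToOrlicz Φ lam (F n))]
  have h3 : orliczModular Φ lam (F n : G → ℂ) (k / l * l) ≤
      orliczModular Φ lam (fun x => (H : G → ℂ) (x * b n)) l := by
    refine orliczModular_le_of_norm_le hl (by positivity) ?_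
    filter_upwards [h2] with x hx
    by_cases hxE : x * b n ∈ E n
    · exact (hF' n x).trans (mul_le_mul_of_nonneg_right (hx hxE) (norm_nonneg _))
    · rw [hF n x hxE, norm_zero]
      positivity
  rw [div_mul_cancel₀ _ hl.ne'] at h3
  refine h3.trans (le_trans (le_of_eq ?_) hHl)
  exact (measurePreserving_mul_right lam (b n)).lintegral_comp
    (f := fun x => ENNReal.ofReal (Φ (‖(H : G → ℂ) x‖ / l)))
    ((Φ.measurable.comp (H.2.1.norm.div_const l)).ennreal_ofReal)

end Translates

/-! ### The weight conditions imply disjoint mixing -/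

/-- A criterion for disjoint mixing: it suffices to approximate on a dense set. -/
theorem DisjointTopologicallyMixing.of_denseRange {X B : Type*} [NormedAddCommGroup X]
    [NormedSpace ℂ X] {L : ℕ} {T : Fin L → X →L[ℂ] X} {J : B → X} (hJ : DenseRange J)
    (h : ∀ (F : B) (H : Fin L → B), ∃ v : ℕ → X, Tendsto v atTop (𝓝 (J F)) ∧
      ∀ l, Tendsto (fun n => (T l ^ n) (v n)) atTop (𝓝 (J (H l)))) :
    DisjointTopologicallyMixing T := by
  intro U V hU hUne hV hVne
  obtain ⟨F, hF⟩ := hJ.exists_mem_open hU hUne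
  choose H hH using fun l => hJ.exists_mem_open (hV l) (hVne l)
  obtain ⟨v, hv, hTv⟩ := h F H
  have h1 := (hv.eventually (hU.mem_nhds hF)).and
    (eventually_all.2 fun l => (hTv l).eventually ((hV l).mem_nhds (hH l)))
  obtain ⟨N, hN⟩ := eventually_atTop.1 h1
  exact ⟨N, fun n hn => ⟨v n, (hN n hn).1, Set.mem_iInter.2 (hN n hn).2⟩⟩

section Sufficiency

variable {G : Type*} [Group G] [TopologicalSpace G] [IsTopologicalGroup G] [MeasurableSpace G]
  [BorelSpace G] [SecondCountableTopology G]

/-- The right inverse of the `n`-th power of a weighted translation, on bounded functions of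
compact support. -/
def weightedTranslationInvPow (a : G) (w : TranslationWeight G) (n : ℕ) :
    boundedCompact G →ₗ[ℂ] boundedCompact G :=
  boundedCompactMulTranslate (fun x => weightProdTilde a w n (x * a ^ n))
    ((continuous_weightProdTilde a w.continuous' w.pos' n).comp (continuous_mul_const (a ^ n)))
    (a ^ n)

/-- The `n`-th power of a weighted translation, on bounded functions of compact support. -/
def weightedTranslationPow (a : G) (w : TranslationWeight G) (n : ℕ) :
    boundedCompact G →ₗ[ℂ] boundedCompact G :=
  boundedCompactMulTranslate (fun x => (weightProdTilde a w n x)⁻¹)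
    ((continuous_weightProdTilde a w.continuous' w.pos' n).inv₀
      fun x => (weightProdTilde_pos a w.pos' n x).ne') (a ^ n)⁻¹

theorem weightedTranslationInvPow_apply (a : G) (w : TranslationWeight G) (n : ℕ)
    (F : boundedCompact G) (x : G) : (weightedTranslationInvPow a w n F : G → ℂ) x =
      (weightProdTilde a w n (x * a ^ n) : ℂ) * (F : G → ℂ) (x * a ^ n) := rfl

theorem weightedTranslationPow_apply (a : G) (w : TranslationWeight G) (n : ℕ)
    (F : boundedCompact G) (x : G) : (weightedTranslationPow a w n F : G → ℂ) x =
      ((weightProdTilde a w n x)⁻¹ : ℝ) * (F : G → ℂ) (x * (a ^ n)⁻¹) := rfl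

theorem weightedTranslationPow_invPow (a : G) (w : TranslationWeight G) (n : ℕ)
    (F : boundedCompact G) :
    weightedTranslationPow a w n (weightedTranslationInvPow a w n F) = F := by
  ext x
  have h : (weightProdTilde a w n x : ℂ) ≠ 0 :=
    Complex.ofReal_ne_zero.2 (weightProdTilde_pos a w.pos' n x).ne'
  rw [weightedTranslationPow_apply, weightedTranslationInvPow_apply, inv_mul_cancel_right,
    Complex.ofReal_inv, inv_mul_cancel_left₀ h]

theorem boundedCompactIndicator_apply_of_notMem {E : Set G} (hE : MeasurableSet E)
    (F : boundedCompact G) {x : G} (hx : x ∉ E) :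
    (boundedCompactIndicator E hE F : G → ℂ) x = 0 := Set.indicator_of_notMem hx _

theorem norm_boundedCompactIndicator_apply_le {E : Set G} (hE : MeasurableSet E)
    (F : boundedCompact G) (x : G) :
    ‖(boundedCompactIndicator E hE F : G → ℂ) x‖ ≤ ‖(F : G → ℂ) x‖ :=
  norm_indicator_le_norm_self _ x

variable (Φ : YoungFunction) (lam : Measure G) [lam.IsMulRightInvariant]
  [IsFiniteMeasureOnCompacts lam] (a : G)

theorem tendsto_weightedTranslationPow_indicator (w : TranslationWeight G) (m : ℕ → ℕ)
    (H : boundedCompact G) {E : ℕ → Set G} (hE : ∀ n, MeasurableSet (E n))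
    (h : Tendsto (fun n => supNormOn lam (weightProd a w (m n)) (E n)) atTop (𝓝 0)) :
    Tendsto (fun n => boundedCompactToOrlicz Φ lam
      (weightedTranslationPow a w (m n) (boundedCompactIndicator (E n) (hE n) H)))
      atTop (𝓝 0) := by
  refine tendsto_zero_of_supNormOn Φ lam H hE (fun n => (a ^ m n)⁻¹) ?_ ?_ h
  · intro n x hx
    rw [weightedTranslationPow_apply, boundedCompactIndicator_apply_of_notMem _ _ hx, mul_zero]
  · intro n x
    rw [weightedTranslationPow_apply, norm_mul, Complex.norm_real]
    have h1 := weightProdTilde_mul_pow a w (m n) (x * (a ^ m n)⁻¹)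
    rw [inv_mul_cancel_right] at h1
    rw [h1, inv_inv]
    gcongr
    exact norm_boundedCompactIndicator_apply_le _ _ _

theorem tendsto_weightedTranslationInvPow_indicator (w : TranslationWeight G) (m : ℕ → ℕ)
    (H : boundedCompact G) {E : ℕ → Set G} (hE : ∀ n, MeasurableSet (E n))
    (h : Tendsto (fun n => supNormOn lam (weightProdTilde a w (m n)) (E n)) atTop (𝓝 0)) :
    Tendsto (fun n => boundedCompactToOrlicz Φ lam
      (weightedTranslationInvPow a w (m n) (boundedCompactIndicator (E n) (hE n) H)))
      atTop (𝓝 0) := by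
  refine tendsto_zero_of_supNormOn Φ lam H hE (fun n => a ^ m n) ?_ ?_ h
  · intro n x hx
    rw [weightedTranslationInvPow_apply, boundedCompactIndicator_apply_of_notMem _ _ hx, mul_zero]
  · intro n x
    rw [weightedTranslationInvPow_apply, norm_mul, Complex.norm_real]
    gcongr
    exact norm_boundedCompactIndicator_apply_le _ _ _

/-- Substituting `y = x a^(-(m-k))`, both operators evaluate `H` at `y`, and their weights combine
into the displayed quotient at `y`. -/
theorem tendsto_weightedTranslationPow_invPow_of_le (w v : TranslationWeight G) {m k : ℕ → ℕ}
    (hkm : ∀ n, k n ≤ m n) (H : boundedCompact G) {E : ℕ → Set G} (hE : ∀ n, MeasurableSet (E n))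
    (h : Tendsto (fun n => supNormOn lam (fun x => weightProd a w (m n - k n) x *
      weightProdTilde a v (k n) x / weightProdTilde a w (k n) x) (E n)) atTop (𝓝 0)) :
    Tendsto (fun n => boundedCompactToOrlicz Φ lam (weightedTranslationPow a w (m n)
      (weightedTranslationInvPow a v (k n) (boundedCompactIndicator (E n) (hE n) H))))
      atTop (𝓝 0) := by
  have hb : ∀ n x, x * (a ^ m n)⁻¹ * a ^ k n = x * (a ^ (m n - k n))⁻¹ := fun n x => by
    have : a ^ m n = a ^ k n * a ^ (m n - k n) := by
      rw [← pow_add, Nat.add_sub_cancel' (hkm n)]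
    rw [this, mul_inv_rev, ← mul_assoc, inv_mul_cancel_right]
  refine tendsto_zero_of_supNormOn Φ lam H hE (fun n => (a ^ (m n - k n))⁻¹) ?_ ?_ h
  · intro n x hx
    rw [weightedTranslationPow_apply, weightedTranslationInvPow_apply, hb,
      boundedCompactIndicator_apply_of_notMem _ _ hx, mul_zero, mul_zero]
  · intro n x
    have h1 := inv_weightProdTilde_mul_pow_sub a w (hkm n) (x * (a ^ (m n - k n))⁻¹)
    rw [inv_mul_cancel_right] at h1
    rw [weightedTranslationPow_apply, weightedTranslationInvPow_apply, hb, h1, ← mul_assoc,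
      norm_mul, ← Complex.ofReal_mul, Complex.norm_real, div_mul_eq_mul_div]
    gcongr
    exact norm_boundedCompactIndicator_apply_le _ _ _

theorem tendsto_weightedTranslationPow_invPow_of_ge (w v : TranslationWeight G) {m k : ℕ → ℕ}
    (hkm : ∀ n, k n ≤ m n) (H : boundedCompact G) {E : ℕ → Set G} (hE : ∀ n, MeasurableSet (E n))
    (h : Tendsto (fun n => supNormOn lam (fun x => weightProdTilde a w (m n - k n) x *
      weightProdTilde a v (m n) x / weightProdTilde a w (m n) x) (E n)) atTop (𝓝 0)) :
    Tendsto (fun n => boundedCompactToOrlicz Φ lam (weightedTranslationPow a w (k n)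
      (weightedTranslationInvPow a v (m n) (boundedCompactIndicator (E n) (hE n) H))))
      atTop (𝓝 0) := by
  have hb : ∀ n x, x * (a ^ k n)⁻¹ * a ^ m n = x * a ^ (m n - k n) := fun n x => by
    have : a ^ m n = a ^ k n * a ^ (m n - k n) := by
      rw [← pow_add, Nat.add_sub_cancel' (hkm n)]
    rw [this, ← mul_assoc, inv_mul_cancel_right]
  refine tendsto_zero_of_supNormOn Φ lam H hE (fun n => a ^ (m n - k n)) ?_ ?_ h
  · intro n x hx
    rw [weightedTranslationPow_apply, weightedTranslationInvPow_apply, hb,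
      boundedCompactIndicator_apply_of_notMem _ _ hx, mul_zero, mul_zero]
  · intro n x
    have h1 := inv_weightProdTilde_mul_inv_pow_sub a w.pos' (hkm n) (x * a ^ (m n - k n))
    rw [mul_inv_cancel_right] at h1
    rw [weightedTranslationPow_apply, weightedTranslationInvPow_apply, hb, h1, ← mul_assoc,
      norm_mul, ← Complex.ofReal_mul, Complex.norm_real, div_mul_eq_mul_div]
    gcongr
    exact norm_boundedCompactIndicator_apply_le _ _ _

theorem disjointTopologicallyMixing_of_weights [T2Space G] [LocallyCompactSpace G]
    [lam.IsOpenPosMeasure] {M : ℝ} (hM : 0 < M)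
    (hΦ : ∀ t > 0, Φ (2 * t) ≤ M * Φ t) {L : ℕ} (w : Fin L → TranslationWeight G)
    {r : Fin L → ℕ} (hr : StrictMono r)
    (h : ∀ K : Set G, IsCompact K → 0 < lam K →
      ∃ E : ℕ → Set G, (∀ n, MeasurableSet (E n) ∧ E n ⊆ K) ∧
        Tendsto (fun n => lam (E n)) atTop (𝓝 (lam K)) ∧
        (∀ l,
          Tendsto (fun n => supNormOn lam (weightProd a (w l) (r l * n)) (E n)) atTop (𝓝 0) ∧
          Tendsto (fun n => supNormOn lam (weightProdTilde a (w l) (r l * n)) (E n))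
            atTop (𝓝 0)) ∧
        (∀ s l, s < l →
          Tendsto (fun n => supNormOn lam
            (fun x => weightProdTilde a (w s) ((r l - r s) * n) x *
              weightProdTilde a (w l) (r l * n) x / weightProdTilde a (w s) (r l * n) x) (E n))
            atTop (𝓝 0) ∧
          Tendsto (fun n => supNormOn lam
            (fun x => weightProd a (w l) ((r l - r s) * n) x *
              weightProdTilde a (w s) (r s * n) x / weightProdTilde a (w l) (r s * n) x) (E n))
            atTop (𝓝 0))) :
    DisjointTopologicallyMixing (fun l => weightedTranslation Φ lam a (w l) ^ r l) := by
  refine .of_denseRange (denseRange_boundedCompactToOrlicz Φ lam hM hΦ) fun F H => ?_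
  obtain ⟨-, -, K₁, hK₁, hFK₁⟩ := F.2
  choose hm hb K₂ hK₂ hHK₂ using fun l => (H l).2
  -- The supports may be null; adding a compact neighbourhood of `1` makes `K` of positive measure.
  obtain ⟨K₃, hK₃, hK₃'⟩ := exists_compact_mem_nhds (1 : G)
  set K : Set G := K₁ ∪ (⋃ l, K₂ l) ∪ K₃ with hKdef
  have hK : IsCompact K := (hK₁.union (isCompact_iUnion hK₂)).union hK₃
  have hFK : ∀ x ∉ K, (F : G → ℂ) x = 0 := fun x hx => hFK₁ x fun h => hx (Or.inl (Or.inl h))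
  have hHK : ∀ l, ∀ x ∉ K, (H l : G → ℂ) x = 0 := fun l x hx =>
    hHK₂ l x fun h => hx (Or.inl (Or.inr (Set.mem_iUnion.2 ⟨l, h⟩)))
  have hKpos : 0 < lam K :=
    (Measure.measure_pos_of_mem_nhds lam hK₃').trans_le (measure_mono Set.subset_union_right)
  obtain ⟨E, hE, hEK, hE1, hE2⟩ := h K hK hKpos
  have hEm := fun n => (hE n).1
  have hdiff : Tendsto (fun n => lam (K \ E n)) atTop (𝓝 0) := by
    have h1 : ∀ n, lam (K \ E n) = lam K - lam (E n) := fun n =>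
      measure_sdiff (hE n).2 (hEm n).nullMeasurableSet
        ((measure_mono (hE n).2).trans_lt hK.measure_lt_top).ne
    simp only [h1]
    have h2 : Tendsto (fun n => lam K - lam (E n)) atTop (𝓝 (lam K - lam K)) :=
      ENNReal.Tendsto.sub tendsto_const_nhds hEK (Or.inl hK.measure_lt_top.ne)
    rwa [tsub_self] at h2
  set J := boundedCompactToOrlicz Φ lam
  let I : ℕ → boundedCompact G →ₗ[ℂ] boundedCompact G :=
    fun n => boundedCompactIndicator (E n) (hEm n)
  refine ⟨fun n => J (I n F + ∑ s, weightedTranslationInvPow a (w s) (r s * n) (I n (H s))),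
    ?_, fun l => ?_⟩
  · simp only [map_add, map_sum]
    have h1 := (tendsto_boundedCompactIndicator Φ lam F hFK hEm hdiff).add
      (tendsto_finsetSum Finset.univ fun s _ =>
        tendsto_weightedTranslationInvPow_indicator Φ lam a (w s) (fun n => r s * n) (H s) hEm
          (hE1 s).2)
    simpa using h1
  · have h0 : ∀ n, ((weightedTranslation Φ lam a (w l) ^ r l) ^ n)
        (J (I n F + ∑ s, weightedTranslationInvPow a (w s) (r s * n) (I n (H s)))) =
        J (weightedTranslationPow a (w l) (r l * n) (I n F)) +
          ∑ s, J (weightedTranslationPow a (w l) (r l * n)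
            (weightedTranslationInvPow a (w s) (r s * n) (I n (H s)))) := by
      intro n
      rw [← pow_mul, ← map_sum, ← map_sum, ← map_add, ← map_add]
      exact weightedTranslation_pow_boundedCompactToOrlicz Φ lam a (w l) (r l * n) _
    simp only [h0]
    have h1 : ∀ s, Tendsto (fun n => J (weightedTranslationPow a (w l) (r l * n)
        (weightedTranslationInvPow a (w s) (r s * n) (I n (H s))))) atTop
        (𝓝 (if s = l then J (H l) else 0)) := by
      intro s
      rcases lt_trichotomy s l with hsl | rfl | hls
      · rw [if_neg hsl.ne]
        refine tendsto_weightedTranslationPow_invPow_of_le Φ lam a (w l) (w s)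
          (fun n => Nat.mul_le_mul_right n (hr hsl).le) (H s) hEm ?_
        simpa only [← Nat.sub_mul] using (hE2 s l hsl).2
      · rw [if_pos rfl]
        simp only [weightedTranslationPow_invPow]
        exact tendsto_boundedCompactIndicator Φ lam (H s) (hHK s) hEm hdiff
      · rw [if_neg hls.ne']
        refine tendsto_weightedTranslationPow_invPow_of_ge Φ lam a (w l) (w s)
          (fun n => Nat.mul_le_mul_right n (hr hls).le) (H s) hEm ?_
        simpa only [← Nat.sub_mul] using (hE2 l s hls).1
    have h2 := (tendsto_weightedTranslationPow_indicator Φ lam a (w l) (fun n => r l * n) F hEm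
      (hE1 l).1).add (tendsto_finsetSum Finset.univ fun s _ => h1 s)
    simpa using h2

end Sufficiency

/-! ### Disjoint mixing implies the weight conditions -/

/-- Diagonal choice: if for every `ε > 0` the property `P n ε` can be satisfied for all large `n`,
then it can be satisfied along a null sequence of tolerances. -/
theorem exists_seq_tendsto_zero_of_forall_eventually {α : Type*} [Nonempty α]
    {P : ℕ → ℝ → α → Prop} (h : ∀ ε > 0, ∀ᶠ n in atTop, ∃ x, P n ε x) :
    ∃ (x : ℕ → α) (e : ℕ → ℝ), Tendsto e atTop (𝓝 0) ∧ ∀ᶠ n in atTop, P n (e n) (x n) := by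
  classical
  choose N hN using fun m : ℕ => eventually_atTop.1 (h (1 / ((m : ℝ) + 1)) (by positivity))
  -- The tolerance at time `n` is `1 / (k n + 1)` for the last threshold `N m` already passed. The
  -- default value `0` of `findGreatest` is legitimate only when `N 0 ≤ n`.
  let k : ℕ → ℕ := fun n => Nat.findGreatest (fun m => N m ≤ n) n
  have hk : Tendsto k atTop atTop := by
    refine tendsto_atTop.2 fun b => ?_
    filter_upwards [eventually_ge_atTop b, eventually_ge_atTop (N b)] with n h1 h2
    exact Nat.le_findGreatest h1 h2
  have hex : ∀ n, ∃ x, N 0 ≤ n → P n (1 / ((k n : ℝ) + 1)) x := by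
    intro n
    by_cases hn : N 0 ≤ n
    · obtain ⟨x, hx⟩ := hN (k n) n (Nat.findGreatest_spec (P := fun m => N m ≤ n) (Nat.zero_le n) hn)
      exact ⟨x, fun _ => hx⟩
    · exact ⟨Classical.arbitrary α, fun h => absurd h hn⟩
  choose x hx using hex
  exact ⟨x, _, tendsto_one_div_add_atTop_nhds_zero_nat.comp hk,
    eventually_atTop.2 ⟨N 0, fun n hn => hx n hn⟩⟩

/-- Markov's inequality for `Φ (|f| / δ)`, whose integral is at most `1` since `‖f‖ < δ`. -/
theorem OrliczSpace.measure_ge_le {α : Type*} [MeasurableSpace α] {Φ : YoungFunction}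
    {μ : Measure α} (f : OrliczSpace Φ μ) {F : α → ℂ} (hF : (f : α →ₘ[μ] ℂ) =ᵐ[μ] F) {δ ε : ℝ}
    (hε : 0 < ε) (hf : ‖f‖ < δ) :
    μ {x | ε ≤ ‖F x‖} ≤ (ENNReal.ofReal (Φ (ε / δ)))⁻¹ := by
  have hδ : 0 < δ := (norm_nonneg f).trans_lt hf
  have hpos : 0 < Φ (ε / δ) := Φ.pos' _ (by positivity)
  obtain ⟨k, hk, hkδ⟩ := exists_lt_of_csInf_lt (OrliczSpace.exists_modular_le_one f)
    (show sInf _ < δ from hf)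
  have h1 : orliczModular Φ μ (f : α →ₘ[μ] ℂ) δ ≤ 1 :=
    (orliczModular_anti hk.1 hkδ.le).trans hk.2
  have hm : Measurable fun x => ENNReal.ofReal (Φ (‖(f : α →ₘ[μ] ℂ) x‖ / δ)) :=
    (Φ.measurable.comp ((f : α →ₘ[μ] ℂ).measurable.norm.div_const δ)).ennreal_ofReal
  have h2 := meas_ge_le_lintegral_div hm.aemeasurable (μ := μ)
    (ENNReal.ofReal_pos.2 hpos).ne' ENNReal.ofReal_ne_top
  calc μ {x | ε ≤ ‖F x‖}
      ≤ μ {x | ENNReal.ofReal (Φ (ε / δ)) ≤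
          ENNReal.ofReal (Φ (‖(f : α →ₘ[μ] ℂ) x‖ / δ))} := by
        refine measure_mono_ae ?_
        filter_upwards [hF] with x hx hεx
        change ε ≤ ‖F x‖ at hεx
        change ENNReal.ofReal _ ≤ ENNReal.ofReal _
        rw [hx]
        exact ENNReal.ofReal_le_ofReal (Φ.mono (by positivity) (by gcongr))
    _ ≤ _ := h2
    _ ≤ _ := by
        rw [← one_div]
        exact ENNReal.div_le_div_right h1 _

/-- Here `d |z| ≥ 1/2` and `c |z| < ε`, so cancelling `|z|` bounds the ratio. -/
theorem div_le_two_mul_of_norm_mul_sub_one_lt {c d ε : ℝ} {z : ℂ} (hd : 0 < d) (hc : 0 < c)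
    (hε : ε ≤ 1 / 2) (h1 : ‖(c : ℂ) * z‖ < ε) (h2 : ‖(d : ℂ) * z - 1‖ < ε) : c / d ≤ 2 * ε := by
  have h3 : 1 - ‖(d : ℂ) * z‖ ≤ ‖(d : ℂ) * z - 1‖ := by
    have := norm_sub_norm_le (1 : ℂ) ((d : ℂ) * z)
    rwa [norm_one, norm_sub_rev] at this
  rw [norm_mul, Complex.norm_of_nonneg hd.le] at h3
  rw [norm_mul, Complex.norm_of_nonneg hc.le] at h1
  rw [div_le_iff₀ hd]
  have h4 : 1 / 2 ≤ d * ‖z‖ := by linarith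
  have h5 : 0 < ‖z‖ := by
    by_contra! h
    nlinarith
  by_contra! h6
  nlinarith

section Necessity

variable {G : Type*} [Group G]

theorem weightProd_le_of_close (a : G) {w : G → ℝ} (hw : ∀ x, 0 < w x) {ε : ℝ} (hε : ε ≤ 1 / 2)
    {f : G → ℂ} {m : ℕ} {x : G} (h1 : ‖f x - 1‖ < ε)
    (h2 : ‖((weightProdTilde a w m (x * a ^ m))⁻¹ : ℝ) * f (x * a ^ m * (a ^ m)⁻¹)‖ < ε) :
    weightProd a w m x ≤ 2 * ε := by
  rw [mul_inv_cancel_right, weightProdTilde_mul_pow, inv_inv] at h2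
  have := div_le_two_mul_of_norm_mul_sub_one_lt one_pos (weightProd_pos a hw m x) hε h2
    (by simpa using h1)
  simpa using this

theorem weightProdTilde_le_of_close (a : G) {w : G → ℝ} (hw : ∀ x, 0 < w x) {ε : ℝ}
    (hε : ε ≤ 1 / 2) {f : G → ℂ} {m : ℕ} {x : G} (h1 : ‖f (x * (a ^ m)⁻¹)‖ < ε)
    (h2 : ‖((weightProdTilde a w m x)⁻¹ : ℝ) * f (x * (a ^ m)⁻¹) - 1‖ < ε) :
    weightProdTilde a w m x ≤ 2 * ε := by
  have := div_le_two_mul_of_norm_mul_sub_one_lt (inv_pos.2 (weightProdTilde_pos a hw m x))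
    one_pos hε (by simpa using h1) h2
  simpa using this

/-- The common value is `z = f (x a⁻ᵏ)`: the `m`-th iterate with weight `w` sees it at `x a^(m-k)`,
where the result is small, and the `k`-th iterate with weight `v` sees it at `x`, where the result
is near `1`. -/
theorem weightProd_mul_div_le_of_close (a : G) {w v : G → ℝ} (hw : ∀ x, 0 < w x)
    (hv : ∀ x, 0 < v x) {ε : ℝ} (hε : ε ≤ 1 / 2) {f : G → ℂ} {m k : ℕ} (hkm : k ≤ m) {x : G}
    (h1 : ‖((weightProdTilde a w m (x * a ^ (m - k)))⁻¹ : ℝ) *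
      f (x * a ^ (m - k) * (a ^ m)⁻¹)‖ < ε)
    (h2 : ‖((weightProdTilde a v k x)⁻¹ : ℝ) * f (x * (a ^ k)⁻¹) - 1‖ < ε) :
    weightProd a w (m - k) x * weightProdTilde a v k x / weightProdTilde a w k x ≤ 2 * ε := by
  have hb : x * a ^ (m - k) * (a ^ m)⁻¹ = x * (a ^ k)⁻¹ := by
    have : a ^ m = a ^ k * a ^ (m - k) := by rw [← pow_add, Nat.add_sub_cancel' hkm]
    rw [this, mul_inv_rev, ← mul_assoc, mul_inv_cancel_right]
  rw [hb, inv_weightProdTilde_mul_pow_sub a w hkm] at h1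
  have := div_le_two_mul_of_norm_mul_sub_one_lt (inv_pos.2 (weightProdTilde_pos a hv k x))
    (div_pos (weightProd_pos a hw _ _) (weightProdTilde_pos a hw _ _)) hε h1 h2
  rwa [div_inv_eq_mul, div_mul_eq_mul_div] at this

theorem weightProdTilde_mul_div_le_of_close (a : G) {w v : G → ℝ} (hw : ∀ x, 0 < w x)
    (hv : ∀ x, 0 < v x) {ε : ℝ} (hε : ε ≤ 1 / 2) {f : G → ℂ} {m k : ℕ} (hkm : k ≤ m) {x : G}
    (h1 : ‖((weightProdTilde a w k (x * (a ^ (m - k))⁻¹))⁻¹ : ℝ) *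
      f (x * (a ^ (m - k))⁻¹ * (a ^ k)⁻¹)‖ < ε)
    (h2 : ‖((weightProdTilde a v m x)⁻¹ : ℝ) * f (x * (a ^ m)⁻¹) - 1‖ < ε) :
    weightProdTilde a w (m - k) x * weightProdTilde a v m x / weightProdTilde a w m x ≤
      2 * ε := by
  have hb : x * (a ^ (m - k))⁻¹ * (a ^ k)⁻¹ = x * (a ^ m)⁻¹ := by
    rw [mul_assoc, ← mul_inv_rev, ← pow_add, Nat.add_sub_cancel' hkm]
  rw [hb, inv_weightProdTilde_mul_inv_pow_sub a hw hkm] at h1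
  have := div_le_two_mul_of_norm_mul_sub_one_lt (inv_pos.2 (weightProdTilde_pos a hv m x))
    (div_pos (weightProdTilde_pos a hw _ _) (weightProdTilde_pos a hw _ _)) hε h1 h2
  rwa [div_inv_eq_mul, div_mul_eq_mul_div] at this

variable [TopologicalSpace G] [IsTopologicalGroup G] [MeasurableSpace G]
  [BorelSpace G] [SecondCountableTopology G]

theorem measure_iUnion_preimage_mul_right_le {ι κ : Type*} [Fintype ι] [Fintype κ]
    (lam : Measure G) [lam.IsMulRightInvariant] (b : κ → G) (S : ι → Set G) {q : ℝ≥0∞}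
    (hS : ∀ i, lam (S i) ≤ q) :
    lam (⋃ j, (fun x => x * b j) ⁻¹' ⋃ i, S i) ≤ Fintype.card κ * (Fintype.card ι * q) := by
  have h1 : lam (⋃ i, S i) ≤ Fintype.card ι * q := by
    refine (measure_iUnion_fintype_le _ _).trans ((Finset.sum_le_sum fun i _ => hS i).trans ?_)
    simp
  refine (measure_iUnion_fintype_le _ _).trans
    ((Finset.sum_le_sum (g := fun _ => Fintype.card ι * q) fun j _ => ?_).trans ?_)
  · rw [measure_preimage_mul_right]
    exact h1
  · simp

variable (Φ : YoungFunction) (lam : Measure G) [lam.IsMulRightInvariant]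
  [IsFiniteMeasureOnCompacts lam] {a : G}

theorem exists_close_set_of_disjointTopologicallyMixing [T2Space G] [LocallyCompactSpace G]
    (ha : IsAperiodic a) {L : ℕ} (w : Fin L → TranslationWeight G)
    {r : Fin L → ℕ} (hr1 : ∀ l, 1 ≤ r l) (hr : StrictMono r)
    (h : DisjointTopologicallyMixing (fun l => weightedTranslation Φ lam a (w l) ^ r l))
    {K : Set G} (hK : IsCompact K) {ε : ℝ} (hε : 0 < ε) :
    ∀ᶠ n : ℕ in atTop, ∃ E : Set G, (MeasurableSet E ∧ E ⊆ K) ∧ lam (K \ E) ≤ ENNReal.ofReal ε ∧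
      ∀ x ∈ E, (∀ l, weightProd a (w l) (r l * n) x ≤ ε ∧
          weightProdTilde a (w l) (r l * n) x ≤ ε) ∧
        ∀ s l, s < l → weightProdTilde a (w s) ((r l - r s) * n) x *
              weightProdTilde a (w l) (r l * n) x / weightProdTilde a (w s) (r l * n) x ≤ ε ∧
            weightProd a (w l) ((r l - r s) * n) x *
              weightProdTilde a (w s) (r s * n) x / weightProdTilde a (w l) (r s * n) x ≤ ε := by
  classical
  have hKm := hK.measurableSet
  -- The index `none` stands for the identity, with exponent `0`. Since each `r l ≥ 1`, all these
  -- exponents are distinct.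
  set e : Option (Fin L) → ℤ := fun i => i.elim 0 fun l => (r l : ℤ) with he
  have he_inj : Function.Injective e := by
    rintro (_ | l) (_ | s) hls
    · rfl
    · have := hr1 s
      simp only [he, Option.elim] at hls
      omega
    · have := hr1 l
      simp only [he, Option.elim] at hls
      omega
    · simp only [he, Option.elim, Nat.cast_inj] at hls
      rw [hr.injective hls]
  obtain ⟨N, hN⟩ := ha.eventually_mul_zpow_notMem hK
  set ε' : ℝ := min (1 / 2) (ε / 2) with hε'def
  have hε' : 0 < ε' := lt_min (by norm_num) (by positivity)
  have hε'1 : ε' ≤ 1 / 2 := min_le_left _ _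
  have hε'2 : 2 * ε' ≤ ε := by linarith [min_le_right (1 / 2) (ε / 2)]
  set p : ℕ := Fintype.card (Option (Fin L) × Option (Fin L)) with hp
  set q : ℕ := Fintype.card (Option (Fin L)) with hq
  -- Up to `p` translates of `q` bad sets, each of measure at most `1 / Φ t`, will be removed; `t`
  -- makes the total at most `ε`, and `δ = ε' / t` gives `ε' / δ = t`.
  obtain ⟨t, htΦ, ht⟩ := ((Φ.tendsto'.eventually_ge_atTop ((p : ℝ) * q / ε)).and
    (eventually_gt_atTop 0)).exists
  have hΦt : (p : ℝ≥0∞) * (q * (ENNReal.ofReal (Φ t))⁻¹) ≤ ENNReal.ofReal ε := by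
    rw [← ENNReal.ofReal_inv_of_pos (Φ.pos' t ht), ← ENNReal.ofReal_natCast p,
      ← ENNReal.ofReal_natCast q, ← ENNReal.ofReal_mul (by positivity),
      ← ENNReal.ofReal_mul (by positivity)]
    refine ENNReal.ofReal_le_ofReal ?_
    have hpos := Φ.pos' t ht
    rw [← mul_assoc, ← div_eq_mul_inv, div_le_iff₀ hpos]
    rwa [div_le_iff₀' hε] at htΦ
  set δ : ℝ := ε' / t with hδ
  have hδ0 : 0 < δ := by positivity
  have hδt : ε' / δ = t := by rw [hδ]; field_simp
  let χ : G → ℂ := K.indicator fun _ => 1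
  have hχ : χ ∈ boundedCompact G := by
    refine ⟨measurable_const.indicator hKm, ⟨1, fun x => ?_⟩, K, hK,
      fun x hx => Set.indicator_of_notMem hx _⟩
    exact (norm_indicator_le_norm_self _ x).trans (by simp)
  set X : OrliczSpace Φ lam := boundedCompactToOrlicz Φ lam ⟨χ, hχ⟩ with hX
  have hXae : (X : G →ₘ[lam] ℂ) =ᵐ[lam] χ := coeFn_boundedCompactToOrlicz Φ lam ⟨χ, hχ⟩
  obtain ⟨N', hN'⟩ := h (Metric.ball X δ) (fun _ => Metric.ball X δ) Metric.isOpen_ball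
    ⟨X, Metric.mem_ball_self hδ0⟩ (fun _ => Metric.isOpen_ball)
    (fun _ => ⟨X, Metric.mem_ball_self hδ0⟩)
  filter_upwards [eventually_ge_atTop N, eventually_ge_atTop N'] with n hnN hnN'
  obtain ⟨v, hv, hTv⟩ := hN' n hnN'
  rw [Set.mem_iInter] at hTv
  set f : G → ℂ := ((v : G →ₘ[lam] ℂ) : G → ℂ) with hf
  let g : Fin L → G → ℂ := fun l x =>
    ((weightProdTilde a (w l) (r l * n) x)⁻¹ : ℝ) * f (x * (a ^ (r l * n))⁻¹)
  let β : Option (Fin L) → G → ℂ := fun i => i.elim f g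
  let S : Option (Fin L) → Set G := fun i => {x | ε' ≤ ‖β i x - χ x‖}
  have hfm : Measurable f := (v : G →ₘ[lam] ℂ).measurable
  have hβm : ∀ i, Measurable (β i) := by
    rintro (_ | l)
    · exact hfm
    · refine Measurable.mul ?_ (hfm.comp (measurable_mul_const _))
      exact Complex.measurable_ofReal.comp
        (continuous_weightProdTilde a (w l).continuous' (w l).pos' _).measurable.inv
  have hSm : ∀ i, MeasurableSet (S i) := fun i =>
    measurableSet_le measurable_const ((hβm i).sub hχ.1).norm
  have hS : ∀ i, lam (S i) ≤ (ENNReal.ofReal (Φ t))⁻¹ := by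
    rw [← hδt]
    rintro (_ | l)
    · refine OrliczSpace.measure_ge_le (v - X) ?_ hε' (mem_ball_iff_norm.1 hv)
      filter_upwards [AEEqFun.coeFn_sub (v : G →ₘ[lam] ℂ) X, hXae] with x h1 h2
      rw [Submodule.coe_sub, h1, Pi.sub_apply, h2]
      rfl
    · refine OrliczSpace.measure_ge_le
        (((weightedTranslation Φ lam a (w l) ^ r l) ^ n) v - X) ?_ hε'
        (mem_ball_iff_norm.1 (hTv l))
      rw [← pow_mul]
      filter_upwards [AEEqFun.coeFn_sub
        (((weightedTranslation Φ lam a (w l) ^ (r l * n)) v : OrliczSpace Φ lam) : G →ₘ[lam] ℂ) X,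
        hXae, coeFn_weightedTranslation_pow Φ lam a (w l) (r l * n) v] with x h1 h2 h3
      rw [Submodule.coe_sub, h1, Pi.sub_apply, h2, h3]
      rfl
  -- These shifts cover every point at which closeness is needed: the diagonal pairs give `x`
  -- itself, and the others leave `K` for large `n`.
  let b : Option (Fin L) × Option (Fin L) → G := fun ij => a ^ ((e ij.1 - e ij.2) * n)
  let D : Set G := ⋃ ij, (fun x => x * b ij) ⁻¹' ⋃ i, S i
  have hDm : MeasurableSet D := MeasurableSet.iUnion fun ij =>
    (measurable_mul_const (b ij)) (MeasurableSet.iUnion hSm)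
  refine ⟨K \ D, ⟨hKm.diff hDm, Set.sdiff_subset⟩, ?_, ?_⟩
  · refine le_trans (measure_mono ?_)
      ((measure_iUnion_preimage_mul_right_le lam b S hS).trans hΦt)
    rw [Set.sdiff_sdiff_right_self]
    exact Set.inter_subset_right
  rintro x ⟨hxK, hxD⟩
  have hclose : ∀ i j k, ‖β k (x * b (i, j)) - χ (x * b (i, j))‖ < ε' := by
    intro i j k
    by_contra! hle
    exact hxD (Set.mem_iUnion.2 ⟨(i, j), Set.mem_iUnion.2 ⟨k, hle⟩⟩)
  have hone : ∀ k, ‖β k x - 1‖ < ε' := by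
    intro k
    have := hclose none none k
    simpa [b, χ, hxK] using this
  have hzero : ∀ i j, i ≠ j → ∀ k, ‖β k (x * b (i, j))‖ < ε' := by
    intro i j hij k
    have h1 : e i - e j ≠ 0 := sub_ne_zero.2 (he_inj.ne hij)
    have h2 : x * b (i, j) ∉ K := by
      refine hN _ ?_ x hxK
      rw [abs_mul, Nat.abs_cast]
      have := Int.one_le_abs h1
      have h3 : (N : ℤ) ≤ n := by exact_mod_cast hnN
      nlinarith
    have h3 := hclose i j k
    rwa [show χ (x * b (i, j)) = 0 from Set.indicator_of_notMem h2 _, sub_zero] at h3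
  have hb1 : ∀ l, b (some l, none) = a ^ (r l * n) := fun l => by
    simp only [b, he, Option.elim, sub_zero]
    rw [← Nat.cast_mul, zpow_natCast]
  have hb2 : ∀ l, b (none, some l) = (a ^ (r l * n))⁻¹ := fun l => by
    simp only [b, he, Option.elim, zero_sub, neg_mul, zpow_neg]
    rw [← Nat.cast_mul, zpow_natCast]
  have hb3 : ∀ s l, s < l → b (some l, some s) = a ^ (r l * n - r s * n) := fun s l hsl => by
    simp only [b, he, Option.elim]
    rw [← Nat.cast_sub (hr hsl).le, ← Nat.cast_mul, zpow_natCast, Nat.sub_mul]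
  have hb4 : ∀ s l, s < l → b (some s, some l) = (a ^ (r l * n - r s * n))⁻¹ := fun s l hsl => by
    rw [← hb3 s l hsl]
    simp only [b]
    rw [← zpow_neg]
    congr 1
    ring
  refine ⟨fun l => ⟨?_, ?_⟩, fun s l hsl => ⟨?_, ?_⟩⟩
  · refine (weightProd_le_of_close a (w l).pos' hε'1 (f := f) (hone none) ?_).trans hε'2
    have hz := hzero (some l) none (by simp) (some l)
    rw [hb1] at hz
    exact hz
  · refine (weightProdTilde_le_of_close a (w l).pos' hε'1 (f := f) ?_ (hone (some l))).trans hε'2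
    have hz := hzero none (some l) (by simp) none
    rw [hb2] at hz
    exact hz
  · rw [Nat.sub_mul]
    refine (weightProdTilde_mul_div_le_of_close a (w s).pos' (w l).pos' hε'1 (f := f)
      (Nat.mul_le_mul_right n (hr hsl).le) ?_ (hone (some l))).trans hε'2
    have hz := hzero (some s) (some l) (by simp [hsl.ne]) (some s)
    rw [hb4 s l hsl] at hz
    exact hz
  · rw [Nat.sub_mul]
    refine (weightProd_mul_div_le_of_close a (w l).pos' (w s).pos' hε'1 (f := f)
      (Nat.mul_le_mul_right n (hr hsl).le) ?_ (hone (some s))).trans hε'2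
    have hz := hzero (some l) (some s) (by simp [hsl.ne']) (some l)
    rw [hb3 s l hsl] at hz
    exact hz

theorem supNormOn_le_of_forall_mem {h : G → ℝ} {E : Set G} (hE : MeasurableSet E) {ε : ℝ}
    (h0 : ∀ x, 0 ≤ h x) (hh : ∀ x ∈ E, h x ≤ ε) : supNormOn lam h E ≤ ENNReal.ofReal ε := by
  rw [supNormOn, eLpNorm_exponent_top]
  refine eLpNormEssSup_le_of_ae_bound (ae_restrict_of_forall_mem hE fun x hx => ?_)
  rw [Real.norm_of_nonneg (h0 x)]
  exact hh x hx

theorem exists_sets_of_disjointTopologicallyMixing [T2Space G] [LocallyCompactSpace G]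
    (ha : IsAperiodic a) {L : ℕ} (w : Fin L → TranslationWeight G)
    {r : Fin L → ℕ} (hr1 : ∀ l, 1 ≤ r l) (hr : StrictMono r)
    (h : DisjointTopologicallyMixing (fun l => weightedTranslation Φ lam a (w l) ^ r l))
    {K : Set G} (hK : IsCompact K) :
    ∃ E : ℕ → Set G, (∀ n, MeasurableSet (E n) ∧ E n ⊆ K) ∧
      Tendsto (fun n => lam (E n)) atTop (𝓝 (lam K)) ∧
      (∀ l,
        Tendsto (fun n => supNormOn lam (weightProd a (w l) (r l * n)) (E n)) atTop (𝓝 0) ∧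
        Tendsto (fun n => supNormOn lam (weightProdTilde a (w l) (r l * n)) (E n))
          atTop (𝓝 0)) ∧
      (∀ s l, s < l →
        Tendsto (fun n => supNormOn lam
          (fun x => weightProdTilde a (w s) ((r l - r s) * n) x *
            weightProdTilde a (w l) (r l * n) x / weightProdTilde a (w s) (r l * n) x) (E n))
          atTop (𝓝 0) ∧
        Tendsto (fun n => supNormOn lam
          (fun x => weightProd a (w l) ((r l - r s) * n) x *
            weightProdTilde a (w s) (r s * n) x / weightProdTilde a (w l) (r s * n) x) (E n))
          atTop (𝓝 0)) := by
  obtain ⟨E₀, e, he, hE⟩ := exists_seq_tendsto_zero_of_forall_eventually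
    fun ε (hε : 0 < ε) =>
      exists_close_set_of_disjointTopologicallyMixing Φ lam ha w hr1 hr h hK hε
  classical
  -- The diagonal choice controls only large `n`; the empty set serves at any other index where `E₀
  -- n` is not a measurable subset of `K`.
  let E : ℕ → Set G := fun n => if MeasurableSet (E₀ n) ∧ E₀ n ⊆ K then E₀ n else ∅
  have hEprop : ∀ n, MeasurableSet (E n) ∧ E n ⊆ K := by
    intro n
    by_cases hn : MeasurableSet (E₀ n) ∧ E₀ n ⊆ K
    · simp only [E, if_pos hn, hn, and_self]
    · simp [E, if_neg hn]
  have hEE₀ : ∀ᶠ n in atTop, E n = E₀ n := hE.mono fun n hn => if_pos hn.1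
  have he' : Tendsto (fun n => ENNReal.ofReal (e n)) atTop (𝓝 0) := by
    simpa using ENNReal.tendsto_ofReal he
  have hsup : ∀ hfun : ℕ → G → ℝ, (∀ n x, 0 ≤ hfun n x) →
      (∀ᶠ n in atTop, ∀ x ∈ E₀ n, hfun n x ≤ e n) →
      Tendsto (fun n => supNormOn lam (hfun n) (E n)) atTop (𝓝 0) := by
    intro hfun h0 hle
    refine tendsto_of_tendsto_of_tendsto_of_le_of_le' tendsto_const_nhds he'
      (Eventually.of_forall fun _ => zero_le) ?_
    filter_upwards [hle, hEE₀] with n hn hEn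
    exact supNormOn_le_of_forall_mem lam (hEprop n).1 (h0 n) (by rwa [hEn])
  have hpos := fun l n x => (weightProd_pos a (w l).pos' n x).le
  have hpos' := fun l n x => (weightProdTilde_pos a (w l).pos' n x).le
  refine ⟨E, hEprop, ?_, fun l => ⟨hsup _ (fun n => hpos l _) ?_, hsup _ (fun n => hpos' l _) ?_⟩,
    fun s l hsl => ⟨hsup _ (fun n x => ?_) ?_, hsup _ (fun n x => ?_) ?_⟩⟩
  · have hd : Tendsto (fun n => lam (K \ E n)) atTop (𝓝 0) := by
      refine tendsto_of_tendsto_of_tendsto_of_le_of_le' tendsto_const_nhds he'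
        (Eventually.of_forall fun _ => zero_le) ?_
      filter_upwards [hE, hEE₀] with n hn hEn
      rw [hEn]
      exact hn.2.1
    have hs : Tendsto (fun n => lam K - lam (K \ E n)) atTop (𝓝 (lam K - 0)) :=
      ENNReal.Tendsto.sub tendsto_const_nhds hd (Or.inl hK.measure_lt_top.ne)
    rw [tsub_zero] at hs
    refine tendsto_of_tendsto_of_tendsto_of_le_of_le hs tendsto_const_nhds (fun n => ?_)
      fun n => measure_mono (hEprop n).2
    rw [tsub_le_iff_right]
    refine (measure_mono fun x hx => ?_).trans (measure_union_le _ _)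
    by_cases hxE : x ∈ E n
    · exact Or.inl hxE
    · exact Or.inr ⟨hx, hxE⟩
  · exact hE.mono fun n hn x hx => ((hn.2.2 x hx).1 l).1
  · exact hE.mono fun n hn x hx => ((hn.2.2 x hx).1 l).2
  · exact div_nonneg (mul_nonneg (hpos' _ _ _) (hpos' _ _ _)) (hpos' _ _ _)
  · exact hE.mono fun n hn x hx => ((hn.2.2 x hx).2 s l hsl).1
  · exact div_nonneg (mul_nonneg (hpos _ _ _) (hpos' _ _ _)) (hpos' _ _ _)
  · exact hE.mono fun n hn x hx => ((hn.2.2 x hx).2 s l hsl).2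

end Necessity

end

theorem corollary2p6 {G : Type*} [Group G] [TopologicalSpace G] [IsTopologicalGroup G]
    [T2Space G] [LocallyCompactSpace G] [SecondCountableTopology G]
    [MeasurableSpace G] [BorelSpace G]
    -- `lam` is a right Haar measure
    (lam : Measure G) [lam.IsMulRightInvariant] [lam.IsOpenPosMeasure]
    [IsFiniteMeasureOnCompacts lam]
    (a : G) (ha : IsAperiodic a)
    (Φ : YoungFunction) (hΦ : Φ.IsDelta2Regular G)
    (L : ℕ) (hL : 2 ≤ L)
    (w : Fin L → TranslationWeight G) (hw : ∀ l, MemLp (fun x => (w l x)⁻¹) ∞ lam)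
    (r : Fin L → ℕ) (hr1 : ∀ l, 1 ≤ r l) (hr : StrictMono r) :
    DisjointTopologicallyMixing (fun l => weightedTranslation Φ lam a (w l) ^ r l) ↔
      ∀ K : Set G, IsCompact K → 0 < lam K →
        ∃ E : ℕ → Set G, (∀ n, MeasurableSet (E n) ∧ E n ⊆ K) ∧
          Tendsto (fun n => lam (E n)) atTop (𝓝 (lam K)) ∧
          (∀ l,
            Tendsto (fun n => supNormOn lam (weightProd a (w l) (r l * n)) (E n)) atTop (𝓝 0) ∧
            Tendsto (fun n => supNormOn lam (weightProdTilde a (w l) (r l * n)) (E n))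
              atTop (𝓝 0)) ∧
          (∀ s l, s < l →
            Tendsto (fun n => supNormOn lam
              (fun x => weightProdTilde a (w s) ((r l - r s) * n) x *
                weightProdTilde a (w l) (r l * n) x / weightProdTilde a (w s) (r l * n) x) (E n))
              atTop (𝓝 0) ∧
            Tendsto (fun n => supNormOn lam
              (fun x => weightProd a (w l) ((r l - r s) * n) x *
                weightProdTilde a (w s) (r s * n) x / weightProdTilde a (w l) (r s * n) x) (E n))
              atTop (𝓝 0)) := by
  -- An aperiodic element forces `G` to be noncompact, so the global form of `Δ₂` is available.
  obtain ⟨M, hM, hΦM⟩ := hΦ.2 ha.noncompactSpace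
  exact ⟨fun h K hK _ => exists_sets_of_disjointTopologicallyMixing Φ lam ha w hr1 hr h hK,
    disjointTopologicallyMixing_of_weights Φ lam a hM hΦM w hr⟩
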